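/- Let $\delta>0$. For $n\ge 1$ and $1\le k\le 2^n$ put $t_k^n=2\pi k\,2^{-n}$ and $\Delta_{kn}=(t_{k-1}^n,t_k^n]$. A stochastic measure on $[0,2\pi]$ is a map $\mu$ from the Borel subsets of $[0,2\pi]$ to the real random variables on a probability space $(\Omega,\mathcal F,\mathsf P)$ that is $\sigma$-additive with respect to convergence in probability; write $\mu_t=\mu((0,t])$ and $S_n=\sum_{k=1}^{2^n}\mu(\Delta_{kn})^2$. There exist integers $2\le n_1<\tilde n_1<n_2<\tilde n_2<\cdots$ such that, with $\alpha_i=1$ if $i\in\bigcup_{j\ge1}[2^{n_j-2},2^{n_j-1}-1]$ and $\alpha_i=0$ otherwise, the following holds for every sequence $\varepsilon_1,\varepsilon_2,\dots$ of independent random variables on a probability space $(\Omega,\mathcal F,\mathsf P)$ with $\mathsf P(\varepsilon_i=1)=\mathsf P(\varepsilon_i=-1)=\tfrac12$. 1. For every Borel set $A\subset[0,2\pi]$ the series $$\mu(A)=\sum_{i=1}^\infty \alpha_i\,\varepsilon_i\int_A\cos(it)\,dt$$ converges almost surely, and $\mu$ is a stochastic measure. The random variables $\mu(A)$ (each determined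 up to almost sure equality) can be chosen so that almost surely the path $t\mapsto\mu_t$ is continuous on $[0,2\pi]$ and Hölder continuous there with every exponent $\gamma<1/2$. 2. Almost surely, $S_{n_j}\ge 2$ and $S_{\tilde n_j}<1$ for all sufficiently large $j$; moreover, with probability at least $1-\delta$, these inequalities hold for all $j\ge 1$. 3. Consequently, almost surely $\lim_{n\to\infty}S_n$ does not exist, and $S_n$ has no limit in probability either. 4. The non-anticipating integral sums $\sum_{k=1}^{2^n} f(\mu_{t_{k-1}^n})\,\mu(\Delta_{kn})$ with $f(x)=x$ have no limit in probability as $n\to\infty$. Hence Itô-type integrals with respect to stochastic measures cannot be defined in general as limits in probability of such sums. -/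

import Mathlib

open MeasureTheory ProbabilityTheory Filter Topology
open scoped NNReal

noncomputable section

namespace StochMeas

/-- `μ` is a stochastic measure on the Borel subsets of `T ⊆ ℝ`: a random variable `μ A` is
attached to every Borel set `A ⊆ T`, and `μ` is `σ`-additive with respect to convergence in
probability. Elements of `L⁰` are represented by measurable functions on `Ω`. -/
structure IsStochasticMeasureOn {Ω : Type*} [MeasurableSpace Ω] (P : Measure Ω) (T : Set ℝ)
    (μ : Set ℝ → Ω → ℝ) : Prop where
  measurable : ∀ A : Set ℝ, MeasurableSet A → A ⊆ T → Measurable (μ A)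
  sigma_additive : ∀ A : ℕ → Set ℝ, (∀ i, MeasurableSet (A i)) → (∀ i, A i ⊆ T) →
    Pairwise (fun i j => Disjoint (A i) (A j)) →
    TendstoInMeasure P (fun N ω => ∑ i ∈ Finset.range N, μ (A i) ω) atTop (μ (⋃ i, A i))

/-- `ε 1, ε 2, …` are symmetric `±1`-valued Bernoulli variables, and the family is independent
(there is no requirement on the law of `ε 0`, which is never used). -/
structure IsBernoulliSequence {Ω : Type*} [MeasurableSpace Ω] (P : Measure Ω)
    (ε : ℕ → Ω → ℝ) : Prop where
  measurable : ∀ i, 1 ≤ i → Measurable (ε i)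
  indep : iIndepFun ε P
  prob_one : ∀ i, 1 ≤ i → P {ω | ε i ω = 1} = 1 / 2
  prob_neg_one : ∀ i, 1 ≤ i → P {ω | ε i ω = -1} = 1 / 2

open Classical in
/-- The coefficients `α i ∈ {0, 1}`: `α i = 1` exactly on the blocks
`2 ^ (n j - 2) ≤ i ≤ 2 ^ (n j - 1) - 1`. Only used when `2 ≤ n j` for all `j`. -/
def blockCoeff (n : ℕ → ℕ) (i : ℕ) : ℝ :=
  if ∃ j, 2 ^ (n j - 2) ≤ i ∧ i < 2 ^ (n j - 1) then 1 else 0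

/-- `μ A` is, almost surely, the sum of the random Fourier series
`∑_{i ≥ 1} α i * ε i * ∫_A cos (i t) dt` for every Borel set `A ⊆ [0, 2π]`. -/
def IsFourierSeriesMeasure {Ω : Type*} [MeasurableSpace Ω] (P : Measure Ω)
    (α : ℕ → ℝ) (ε : ℕ → Ω → ℝ) (μ : Set ℝ → Ω → ℝ) : Prop :=
  ∀ A : Set ℝ, MeasurableSet A → A ⊆ Set.Icc 0 (2 * Real.pi) →
    ∀ᵐ ω ∂P, Tendsto
      (fun N : ℕ => ∑ i ∈ Finset.Icc 1 N, α i * ε i ω * ∫ t in A, Real.cos ((i : ℝ) * t))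
      atTop (𝓝 (μ A ω))

/-- The process `μ_t = μ((0, t])`. -/
def path {Ω : Type*} (μ : Set ℝ → Ω → ℝ) (t : ℝ) (ω : Ω) : ℝ := μ (Set.Ioc 0 t) ω

/-- The dyadic point `t_k = 2π k / 2 ^ n`. -/
def dyadicPoint (n k : ℕ) : ℝ := 2 * Real.pi * (k : ℝ) / 2 ^ n

/-- The dyadic interval `Δ_{kn} = (t_{k-1}, t_k]`, for `1 ≤ k ≤ 2 ^ n`. -/
def dyadicInterval (n k : ℕ) : Set ℝ := Set.Ioc (dyadicPoint n (k - 1)) (dyadicPoint n k)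

/-- `S_n = ∑_{k = 1}^{2 ^ n} μ(Δ_{kn})²`. -/
def dyadicSum {Ω : Type*} (μ : Set ℝ → Ω → ℝ) (n : ℕ) (ω : Ω) : ℝ :=
  ∑ k ∈ Finset.Icc 1 (2 ^ n), μ (dyadicInterval n k) ω ^ 2

/-- The non-anticipating integral sum `∑_{k = 1}^{2 ^ n} f(μ_{t_{k-1}}) μ(Δ_{kn})`. -/
def itoSum {Ω : Type*} (μ : Set ℝ → Ω → ℝ) (f : ℝ → ℝ) (n : ℕ) (ω : Ω) : ℝ :=
  ∑ k ∈ Finset.Icc 1 (2 ^ n), f (path μ (dyadicPoint n (k - 1)) ω) * μ (dyadicInterval n k) ω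

end StochMeas

end

/-! Integrating $\cos(it)$ over $\Delta_{kn}$ gives $\frac2i\sin(i\pi/2^n)$ times the cosine at the
midpoint of the interval. For frequencies $i<2^{n-1}$ these midpoint cosine vectors are orthogonal
in $k$ (`sum_sq_sum_cos_odd`). A block of such frequencies therefore contributes to $S_n$ an amount
depending only on $\varepsilon_i^2=1$, so it is deterministic. For the block $[2^{n-2},2^{n-1})$ it
is a Riemann sum of $2\sin^2(\pi x)/x^2$ over $[1/4,1/2)$, which is at least $9/4$
(`le_sum_block_sq`).

All other frequencies are negligible if the levels grow fast. Frequencies below $2^q$ contribute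
$O(2^{2q-n})$, because each increment is at most $2^q\cdot 2\pi 2^{-n}$ (`sum_partialSum_sq_le`).
Frequencies from $M$ on contribute at most $2^n\cdot 8/M$ in expectation
(`measure_le_remainderSum_le`). With $n_{j+1}=9n_j$ the sum exceeds $2$ at level $n_j$. At level
$\tilde n_j=3n_j$ no block resonates, and the sum is below $1$. The exceptional probabilities are
bounded by $2^{-K-j}$ with $n_1=K$: Borel–Cantelli gives the eventual statement, and a large $K$
gives the one with probability $1-\delta$.

Bessel's inequality yields $\mathsf E\mu(A)^2\le\pi|A|$, hence $\sigma$-additivity in probability.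
Path regularity comes from Hoeffding bounds on the dyadic frequency blocks: the block $p$ has size
about $p2^{-p/2}$ and derivative about $p2^{p/2}$, and interpolating between the two gives every
exponent below $1/2$ (`ae_holderOnWith_path`). Finally $\mu_{2\pi}=0$, since $\sin(2\pi i)=0$, so
summation by parts identifies the Itô sum with $-S_n/2$ (`itoSum_eq`), and it oscillates as well. -/

namespace StochMeas

variable {Ω : Type*} [MeasurableSpace Ω] {P : Measure Ω} [IsProbabilityMeasure P]
  {ε : ℕ → Ω → ℝ}

/-! ### Rademacher sums: moments, almost sure convergence, concentration -/

namespace IsBernoulliSequence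

lemma ae_eq_one_or (h : IsBernoulliSequence P ε) {i : ℕ} (hi : 1 ≤ i) :
    ∀ᵐ ω ∂P, ε i ω = 1 ∨ ε i ω = -1 := by
  have h1 : MeasurableSet {ω | ε i ω = 1} := h.measurable i hi (measurableSet_singleton 1)
  have h2 : MeasurableSet {ω | ε i ω = -1} := h.measurable i hi (measurableSet_singleton (-1))
  have hd : Disjoint {ω | ε i ω = 1} {ω | ε i ω = -1} := by
    rw [Set.disjoint_left]
    intro ω (h3 : ε i ω = 1) (h4 : ε i ω = -1)
    linarith
  have hu : P ({ω | ε i ω = 1} ∪ {ω | ε i ω = -1}) = 1 := by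
    rw [measure_union hd h2, h.prob_one i hi, h.prob_neg_one i hi]
    exact ENNReal.add_halves 1
  exact (prob_compl_eq_zero_iff (h1.union h2)).2 hu

lemma integral_eq_zero (h : IsBernoulliSequence P ε) {i : ℕ} (hi : 1 ≤ i) :
    ∫ ω, ε i ω ∂P = 0 := by
  have h1 : MeasurableSet {ω | ε i ω = 1} := h.measurable i hi (measurableSet_singleton 1)
  have h2 : MeasurableSet {ω | ε i ω = -1} := h.measurable i hi (measurableSet_singleton (-1))
  have he : ε i =ᵐ[P] fun ω => {ω | ε i ω = 1}.indicator (fun _ => (1 : ℝ)) ω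
      - {ω | ε i ω = -1}.indicator (fun _ => (1 : ℝ)) ω := by
    filter_upwards [h.ae_eq_one_or hi] with ω hω
    rcases hω with hω | hω
    · simp [Set.indicator, hω]; norm_num
    · simp [Set.indicator, hω]; norm_num
  rw [integral_congr_ae he, integral_sub ((integrable_const _).indicator h1)
    ((integrable_const _).indicator h2), integral_indicator_const _ h1,
    integral_indicator_const _ h2]
  simp [Measure.real, h.prob_one i hi, h.prob_neg_one i hi]

lemma ae_mem_Icc (h : IsBernoulliSequence P ε) {i : ℕ} (hi : 1 ≤ i) :
    ∀ᵐ ω ∂P, ε i ω ∈ Set.Icc (-1 : ℝ) 1 := by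
  filter_upwards [h.ae_eq_one_or hi] with ω hω
  rcases hω with hω | hω <;> simp [hω]

lemma ae_abs_eq_one (h : IsBernoulliSequence P ε) :
    ∀ᵐ ω ∂P, ∀ i, 1 ≤ i → |ε i ω| = 1 := by
  rw [ae_all_iff]
  intro i
  by_cases hi : 1 ≤ i
  · filter_upwards [h.ae_eq_one_or hi] with ω hω _
    rcases hω with hω | hω <;> simp [hω]
  · exact Eventually.of_forall fun ω h' => absurd h' hi

lemma memLp (h : IsBernoulliSequence P ε) {i : ℕ} (hi : 1 ≤ i) (p : ENNReal) :
    MemLp (ε i) p P :=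
  MemLp.of_bound (h.measurable i hi).aestronglyMeasurable 1 <| by
    filter_upwards [h.ae_abs_eq_one] with ω hω
    simpa using (hω i hi).le

omit [IsProbabilityMeasure P] in
lemma measurable_sum (h : IsBernoulliSequence P ε) (a : ℕ → ℝ) {s : Finset ℕ}
    (hs : ∀ i ∈ s, 1 ≤ i) : Measurable fun ω => ∑ i ∈ s, a i * ε i ω :=
  Finset.measurable_fun_sum _ fun i hi => (h.measurable i (hs i hi)).const_mul _

lemma memLp_sum (h : IsBernoulliSequence P ε) (a : ℕ → ℝ) {s : Finset ℕ}
    (hs : ∀ i ∈ s, 1 ≤ i) (p : ENNReal) : MemLp (fun ω => ∑ i ∈ s, a i * ε i ω) p P :=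
  memLp_finsetSum _ fun i hi => (h.memLp (hs i hi) p).const_mul _

lemma integral_sum_sq (h : IsBernoulliSequence P ε) (a : ℕ → ℝ) {s : Finset ℕ}
    (hs : ∀ i ∈ s, 1 ≤ i) :
    ∫ ω, (∑ i ∈ s, a i * ε i ω) ^ 2 ∂P = ∑ i ∈ s, a i ^ 2 := by
  have hL : ∀ i ∈ s, MemLp (fun ω => a i * ε i ω) 2 P := fun i hi =>
    (h.memLp (hs i hi) 2).const_mul _
  have hv := IndepFun.variance_sum (μ := P) (X := fun i ω => a i * ε i ω) (s := s) hL
    (fun i _ j _ hij => (h.indep.indepFun hij).comp (measurable_const_mul (a i))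
      (measurable_const_mul (a j)))
  have hf : (∑ i ∈ s, fun ω => a i * ε i ω) = fun ω => ∑ i ∈ s, a i * ε i ω := by
    ext ω; simp
  rw [hf, variance_of_integral_eq_zero (h.measurable_sum a hs).aemeasurable] at hv
  · rw [hv]
    refine Finset.sum_congr rfl fun i hi => ?_
    rw [variance_const_mul, variance_of_integral_eq_zero (h.measurable i (hs i hi)).aemeasurable
      (h.integral_eq_zero (hs i hi))]
    have : (fun ω => ε i ω ^ 2) =ᵐ[P] fun _ => 1 := by
      filter_upwards [h.ae_abs_eq_one] with ω hω
      rw [← sq_abs, hω i (hs i hi), one_pow]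
    rw [integral_congr_ae this]
    simp
  · rw [integral_finsetSum _ fun i hi => (hL i hi).integrable (by norm_num)]
    refine Finset.sum_eq_zero fun i hi => ?_
    rw [integral_const_mul, h.integral_eq_zero (hs i hi), mul_zero]

lemma lintegral_sum_sq (h : IsBernoulliSequence P ε) (a : ℕ → ℝ) {s : Finset ℕ}
    (hs : ∀ i ∈ s, 1 ≤ i) :
    ∫⁻ ω, ENNReal.ofReal ((∑ i ∈ s, a i * ε i ω) ^ 2) ∂P = ENNReal.ofReal (∑ i ∈ s, a i ^ 2) := by
  rw [← h.integral_sum_sq a hs, ofReal_integral_eq_lintegral_ofReal]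
  · exact (h.memLp_sum a hs 2).integrable_sq
  · exact Eventually.of_forall fun ω => sq_nonneg _

/-- Fatou bound for the second moment of the almost sure sum of a Rademacher series. -/
lemma lintegral_sq_le (h : IsBernoulliSequence P ε) (a : ℕ → ℝ) {V : ℝ} {N : ℕ → ℕ} {X : Ω → ℝ}
    (hV : ∀ p, ∑ i ∈ Finset.Icc 1 (N p), a i ^ 2 ≤ V)
    (hX : ∀ᵐ ω ∂P, Tendsto (fun p => ∑ i ∈ Finset.Icc 1 (N p), a i * ε i ω) atTop (𝓝 (X ω))) :
    ∫⁻ ω, ENNReal.ofReal (X ω ^ 2) ∂P ≤ ENNReal.ofReal V := by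
  have hs : ∀ p, ∀ i ∈ Finset.Icc 1 (N p), 1 ≤ i := fun p i hi => (Finset.mem_Icc.1 hi).1
  calc ∫⁻ ω, ENNReal.ofReal (X ω ^ 2) ∂P
      = ∫⁻ ω, liminf (fun p => ENNReal.ofReal ((∑ i ∈ Finset.Icc 1 (N p), a i * ε i ω) ^ 2))
          atTop ∂P := by
        refine lintegral_congr_ae ?_
        filter_upwards [hX] with ω hω
        exact (((ENNReal.continuous_ofReal.tendsto _).comp (hω.pow 2)).liminf_eq).symm
    _ ≤ liminf (fun p => ∫⁻ ω, ENNReal.ofReal ((∑ i ∈ Finset.Icc 1 (N p), a i * ε i ω) ^ 2) ∂P)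
          atTop :=
        lintegral_liminf_le fun p => ((h.measurable_sum a (hs p)).pow_const 2).ennreal_ofReal
    _ ≤ ENNReal.ofReal V := by
        refine liminf_le_of_le (by isBoundedDefault) fun b hb => ?_
        obtain ⟨p, hp⟩ := hb.exists
        rw [h.lintegral_sum_sq a (hs p)] at hp
        exact hp.trans (ENNReal.ofReal_le_ofReal (hV p))

/-- Almost sure convergence of Rademacher series with square summable coefficients. -/
lemma ae_exists_tendsto (h : IsBernoulliSequence P ε) (a : ℕ → ℝ) {V : ℝ}
    (hV : ∀ N, ∑ i ∈ Finset.Icc 1 N, a i ^ 2 ≤ V) :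
    ∀ᵐ ω ∂P, ∃ l, Tendsto (fun N => ∑ i ∈ Finset.Icc 1 N, a i * ε i ω) atTop (𝓝 l) := by
  -- The index is shifted because nothing is known about `ε 0`, not even measurability.
  set ξ : ℕ → Ω → ℝ := fun i => ε (i + 1)
  have hm : ∀ i, StronglyMeasurable (ξ i) := fun i =>
    (h.measurable (i + 1) (by omega)).stronglyMeasurable
  have hi : iIndepFun ξ P := h.indep.precomp (g := fun i => i + 1) (add_left_injective 1)
  set Y : ℕ → Ω → ℝ := fun N ω => ∑ i ∈ Finset.Icc 1 (N + 1), a i * ε i ω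
  have hs : ∀ N, ∀ i ∈ Finset.Icc 1 (N + 1), 1 ≤ i := fun p i hi => (Finset.mem_Icc.1 hi).1
  have hY : ∀ N ω, Y (N + 1) ω = Y N ω + a (N + 2) * ξ (N + 1) ω := fun N ω =>
    Finset.sum_Icc_succ_top (by omega) _
  have hmart : Martingale Y (Filtration.natural ξ hm) P := by
    refine martingale_of_condExp_sub_eq_zero_nat (fun N => ?_)
      (fun N => (h.memLp_sum a (hs N) 1).integrable le_rfl) fun N => ?_
    · refine Finset.stronglyMeasurable_fun_sum _ fun i hi => ?_
      obtain ⟨hi1, hi2⟩ := Finset.mem_Icc.1 hi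
      obtain ⟨k, rfl⟩ : ∃ k, i = k + 1 := ⟨i - 1, by omega⟩
      exact (((Filtration.stronglyAdapted_natural hm) k).mono
        ((Filtration.natural ξ hm).mono (by omega))).const_mul _
    · have h1 : Y (N + 1) - Y N = fun ω => a (N + 2) * ξ (N + 1) ω := by
        ext ω; simp [hY]
      rw [h1]
      have h2 := hi.condExp_natural_ae_eq_of_lt hm (Nat.lt_succ_self N)
      have h3 := condExp_smul (a (N + 2)) (ξ (N + 1)) (Filtration.natural ξ hm N) (μ := P)
      filter_upwards [h2, h3] with ω h4 h5
      refine h5.trans ?_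
      rw [Pi.smul_apply, h4]
      have : ∫ ω, ξ (N + 1) ω ∂P = 0 := h.integral_eq_zero (by omega)
      simp [this]
  -- Boundedness in $L^2$ gives boundedness in $L^1$, which is what the martingale convergence
  -- theorem needs.
  have hb : ∀ N, eLpNorm (Y N) 1 P ≤ ((Real.sqrt V).toNNReal : ENNReal) := by
    intro N
    have hV0 : 0 ≤ V := le_trans (by simp) (hV 0)
    refine (eLpNorm_le_eLpNorm_of_exponent_le (p := 1) (q := 2) (by norm_num)
      (h.memLp_sum a (hs N) 2).1).trans ?_
    rw [(h.memLp_sum a (hs N) 2).eLpNorm_eq_integral_rpow_norm (by norm_num) (by norm_num)]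
    refine ENNReal.ofReal_le_ofReal ?_
    have := h.integral_sum_sq a (hs N)
    simp only [ENNReal.toReal_ofNat, Real.rpow_ofNat, Real.norm_eq_abs, sq_abs]
    rw [this, Real.sqrt_eq_rpow, one_div]
    exact Real.rpow_le_rpow (Finset.sum_nonneg fun _ _ => sq_nonneg _) (hV _) (by norm_num)
  filter_upwards [hmart.submartingale.exists_ae_tendsto_of_bdd hb] with ω ⟨l, hl⟩
  exact ⟨l, (tendsto_add_atTop_iff_nat 1).1 hl⟩

/-- Two-sided Hoeffding bound for Rademacher sums. -/
lemma measure_abs_sum_ge_le (h : IsBernoulliSequence P ε) (a : ℕ → ℝ) {s : Finset ℕ}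
    (hs : ∀ i ∈ s, 1 ≤ i) {V x : ℝ} (hV : ∑ i ∈ s, a i ^ 2 ≤ V) (hx : 0 ≤ x) :
    P.real {ω | x ≤ |∑ i ∈ s, a i * ε i ω|} ≤ 2 * Real.exp (-x ^ 2 / (2 * V)) := by
  have key : ∀ b : ℕ → ℝ, ∑ i ∈ s, b i ^ 2 ≤ V →
      P.real {ω | x ≤ ∑ i ∈ s, b i * ε i ω} ≤ Real.exp (-x ^ 2 / (2 * V)) := by
    intro b hb
    have hsub : ∀ i ∈ s, HasSubgaussianMGF (fun ω => b i * ε i ω) (‖b i‖₊ ^ 2) P := by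
      intro i hi
      -- Hoeffding's lemma on $[-1,1]$: the variance proxy is $((1-(-1))/2)^2=1$.
      have := (hasSubgaussianMGF_of_mem_Icc_of_integral_eq_zero
        (h.measurable i (hs i hi)).aemeasurable (h.ae_mem_Icc (hs i hi))
        (h.integral_eq_zero (hs i hi))).const_mul (b i)
      refine (congrArg (fun c => HasSubgaussianMGF (fun ω => b i * ε i ω) c P) ?_).mp this
      apply NNReal.eq
      norm_num
      exact mul_one (b i ^ 2)
    have hind : iIndepFun (fun i ω => b i * ε i ω) P :=
      h.indep.comp (fun i y => b i * y) fun i => measurable_const_mul (b i)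
    rcases hx.eq_or_lt with rfl | hx
    · simp
    -- If all coefficients vanish, the exponent $-x^2/(2\cdot 0)$ is read as $0$ and the Hoeffding
    -- bound says nothing. The event is empty in that case.
    by_cases hz : ∀ i ∈ s, b i = 0
    · have : {ω | x ≤ ∑ i ∈ s, b i * ε i ω} = ∅ := by
        ext ω
        rw [Set.mem_ofPred_eq, Finset.sum_eq_zero fun i hi => by rw [hz i hi, zero_mul]]
        simpa using hx
      rw [this, measureReal_empty]
      positivity
    refine ((HasSubgaussianMGF.sum_of_iIndepFun hind hsub).measure_ge_le hx.le).trans ?_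
    have hc : ((∑ i ∈ s, ‖b i‖₊ ^ 2 : ℝ≥0) : ℝ) = ∑ i ∈ s, b i ^ 2 := by simp
    rw [hc]
    have h0 : 0 < ∑ i ∈ s, b i ^ 2 := by
      push Not at hz
      obtain ⟨i, hi, hb0⟩ := hz
      exact Finset.sum_pos' (fun _ _ => sq_nonneg _) ⟨i, hi, by positivity⟩
    rw [Real.exp_le_exp, neg_div, neg_div, neg_le_neg_iff]
    gcongr
  have hset : {ω | x ≤ |∑ i ∈ s, a i * ε i ω|} ⊆
      {ω | x ≤ ∑ i ∈ s, a i * ε i ω} ∪ {ω | x ≤ ∑ i ∈ s, -a i * ε i ω} := by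
    intro ω (hω : x ≤ |_|)
    simpa [← Finset.sum_neg_distrib] using le_abs.1 hω
  calc _ ≤ _ := measureReal_mono hset
    _ ≤ _ := measureReal_union_le _ _
    _ ≤ _ := by
      have := key a hV
      have := key (fun i => -a i) (by simpa using hV)
      linarith

end IsBernoulliSequence

/-! ### Fourier coefficients -/

lemma integrable_cos_restrict {A : Set ℝ} (hA : A ⊆ Set.Icc 0 (2 * Real.pi)) (i : ℕ) :
    IntegrableOn (fun t => Real.cos (i * t)) A :=
  ((by fun_prop : Continuous fun t : ℝ => Real.cos (i * t)).integrableOn_Icc).mono_set hA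

lemma setIntegral_cos_Ioc {i : ℕ} (hi : 1 ≤ i) {s t : ℝ} (hst : s ≤ t) :
    ∫ x in Set.Ioc s t, Real.cos (i * x) = (Real.sin (i * t) - Real.sin (i * s)) / i := by
  have hi' : (i : ℝ) ≠ 0 := by positivity
  rw [← intervalIntegral.integral_of_le hst,
    intervalIntegral.integral_comp_mul_left (fun x => Real.cos x) hi', integral_cos, smul_eq_mul]
  ring

lemma abs_setIntegral_cos_Ioc_le (i : ℕ) {s t : ℝ} (hst : s ≤ t) :
    |∫ x in Set.Ioc s t, Real.cos (i * x)| ≤ t - s := by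
  have := norm_setIntegral_le_of_norm_le_const (μ := volume) (s := Set.Ioc s t) (C := 1)
    (f := fun x => Real.cos (i * x)) (by simp) fun x _ => Real.abs_cos_le_one _
  simpa [Real.volume_real_Ioc_of_le hst] using this

lemma setIntegral_cos_Ioc_sq_le {i : ℕ} (hi : 1 ≤ i) {s t : ℝ} (hst : s ≤ t) :
    (∫ x in Set.Ioc s t, Real.cos (i * x)) ^ 2 ≤ 4 * ((i : ℝ) ^ 2)⁻¹ := by
  rw [setIntegral_cos_Ioc hi hst, div_pow, div_eq_mul_inv]
  gcongr
  have h1 := Real.abs_sin_le_one (i * t)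
  have h2 := Real.abs_sin_le_one (i * s)
  rw [abs_le] at h1 h2
  nlinarith

lemma integral_cos_int_mul {k : ℤ} (hk : k ≠ 0) :
    ∫ t in (0 : ℝ)..2 * Real.pi, Real.cos (k * t) = 0 := by
  have hk' : (k : ℝ) ≠ 0 := by exact_mod_cast hk
  rw [intervalIntegral.integral_comp_mul_left (fun x => Real.cos x) hk', integral_cos]
  have : Real.sin (k * (2 * Real.pi)) = 0 := by
    have := Real.sin_int_mul_pi (2 * k)
    rw [← this]; push_cast; ring_nf
  simp [this]

lemma integral_cos_mul_cos {i j : ℕ} (hi : 1 ≤ i) :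
    ∫ t in (0 : ℝ)..2 * Real.pi, Real.cos (i * t) * Real.cos (j * t)
      = if i = j then Real.pi else 0 := by
  have h : ∀ t : ℝ, Real.cos (i * t) * Real.cos (j * t)
      = (Real.cos (((i : ℤ) - j : ℤ) * t) + Real.cos (((i : ℤ) + j : ℤ) * t)) / 2 := by
    intro t
    push_cast
    rw [sub_mul, add_mul, Real.cos_sub, Real.cos_add]
    ring
  simp_rw [h]
  rw [intervalIntegral.integral_div, intervalIntegral.integral_add
    (Continuous.intervalIntegrable (by fun_prop) _ _)
    (Continuous.intervalIntegrable (by fun_prop) _ _),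
    integral_cos_int_mul (k := (i : ℤ) + j) (by omega)]
  split_ifs with hij
  · subst hij; simp
  · rw [integral_cos_int_mul (by omega)]; simp

/-- **Bessel's inequality** for the cosine coefficients of an indicator function. -/
lemma sum_setIntegral_cos_sq_le {A : Set ℝ} (hA : MeasurableSet A)
    (hA' : A ⊆ Set.Icc 0 (2 * Real.pi)) (N : ℕ) :
    ∑ i ∈ Finset.Icc 1 N, (∫ t in A, Real.cos (i * t)) ^ 2 ≤ Real.pi * volume.real A := by
  set c : ℕ → ℝ := fun i => ∫ t in A, Real.cos (i * t)
  set I := Set.Icc 0 (2 * Real.pi)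
  have hpi := Real.pi_pos
  set f : ℝ → ℝ := A.indicator fun _ => 1
  set g : ℝ → ℝ := fun t => ∑ i ∈ Finset.Icc 1 N, c i / Real.pi * Real.cos (i * t)
  have hg : Continuous g := by fun_prop
  have hfg : ∀ i ∈ Finset.Icc 1 N, ∫ t in I, f t * (c i / Real.pi * Real.cos (i * t))
      = c i ^ 2 / Real.pi := by
    intro i _
    have : (fun t => f t * (c i / Real.pi * Real.cos (i * t)))
        = A.indicator fun t => c i / Real.pi * Real.cos (i * t) := by
      ext t; by_cases ht : t ∈ A <;> simp [f, ht]
    rw [this, setIntegral_indicator hA, Set.inter_eq_self_of_subset_right hA', integral_const_mul]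
    change c i / Real.pi * c i = _
    ring
  have hintA : ∀ i : ℕ, IntegrableOn (fun t => f t * (c i / Real.pi * Real.cos (i * t))) I := by
    intro i
    have : (fun t => f t * (c i / Real.pi * Real.cos (i * t)))
        = A.indicator fun t => c i / Real.pi * Real.cos (i * t) := by
      ext t; by_cases ht : t ∈ A <;> simp [f, ht]
    rw [this]
    exact IntegrableOn.indicator (Continuous.integrableOn_Icc (by fun_prop)) hA
  have hff : ∫ t in I, f t ^ 2 = volume.real A := by
    have : (fun t => f t ^ 2) = A.indicator fun _ => 1 := by
      ext t; by_cases ht : t ∈ A <;> simp [f, ht]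
    rw [this, setIntegral_indicator hA, Set.inter_eq_self_of_subset_right hA']
    simp
  have hffi : IntegrableOn (fun t => f t ^ 2) I := by
    have : (fun t => f t ^ 2) = A.indicator fun _ => 1 := by
      ext t; by_cases ht : t ∈ A <;> simp [f, ht]
    rw [this]
    exact IntegrableOn.indicator (integrableOn_const measure_Icc_lt_top.ne) hA
  have hfgs : ∫ t in I, f t * g t = (∑ i ∈ Finset.Icc 1 N, c i ^ 2) / Real.pi := by
    simp only [g, Finset.mul_sum]
    rw [integral_finsetSum _ fun i _ => hintA i, Finset.sum_congr rfl hfg, Finset.sum_div]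
  have hfgi : IntegrableOn (fun t => f t * g t) I := by
    simp only [g, Finset.mul_sum]
    exact integrable_finsetSum _ fun i _ => hintA i
  have hgg : ∫ t in I, g t ^ 2 = (∑ i ∈ Finset.Icc 1 N, c i ^ 2) / Real.pi := by
    rw [integral_Icc_eq_integral_Ioc, ← intervalIntegral.integral_of_le (by positivity)]
    simp only [g, sq, Finset.sum_mul_sum]
    rw [intervalIntegral.integral_finsetSum fun i _ =>
      Continuous.intervalIntegrable (by fun_prop) _ _, Finset.sum_div]
    refine Finset.sum_congr rfl fun i hi => ?_
    rw [intervalIntegral.integral_finsetSum fun i _ =>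
      Continuous.intervalIntegrable (by fun_prop) _ _]
    have : ∀ j ∈ Finset.Icc 1 N, (∫ t in (0 : ℝ)..2 * Real.pi, c i / Real.pi * Real.cos (i * t) *
        (c j / Real.pi * Real.cos (j * t))) = if i = j then c i * c i / Real.pi else 0 := by
      intro j _
      have : ∀ t : ℝ, c i / Real.pi * Real.cos (i * t) * (c j / Real.pi * Real.cos (j * t))
          = c i * c j / Real.pi ^ 2 * (Real.cos (i * t) * Real.cos (j * t)) := fun t => by ring
      simp_rw [this]
      rw [intervalIntegral.integral_const_mul, integral_cos_mul_cos (Finset.mem_Icc.1 hi).1]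
      split_ifs with hij
      · subst hij; field_simp
      · simp
    rw [Finset.sum_congr rfl this, Finset.sum_ite_eq, if_pos hi]
  -- `g` is the projection of the indicator onto the cosines, so $\int fg=\int g^2=\sum c_i^2/\pi$,
  -- and expanding the square gives the inequality.
  have hnn : 0 ≤ ∫ t in I, (f t - g t) ^ 2 := integral_nonneg fun t => sq_nonneg _
  have hexp : ∫ t in I, (f t - g t) ^ 2
      = ∫ t in I, (f t ^ 2 - 2 * (f t * g t) + g t ^ 2) := by
    congr 1; ext t; ring
  have hsub : IntegrableOn (fun t => f t ^ 2 - 2 * (f t * g t)) I := hffi.sub (hfgi.const_mul 2)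
  rw [hexp, integral_add hsub (Continuous.integrableOn_Icc (by fun_prop)),
    integral_sub hffi (hfgi.const_mul 2), integral_const_mul, hff, hfgs, hgg] at hnn
  have : (∑ i ∈ Finset.Icc 1 N, c i ^ 2) / Real.pi ≤ volume.real A := by linarith
  rw [div_le_iff₀ hpi] at this
  linarith

lemma sum_Ioc_inv_sq_le' {M : ℕ} (r N : ℕ) (hM : M ≤ r + 1) (hM1 : 1 ≤ M) :
    ∑ i ∈ Finset.Ioc r N, ((i : ℝ) ^ 2)⁻¹ ≤ 2 / M := by
  have h := sum_Ioo_inv_sq_le (α := ℝ) r (N + 1)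
  have he : Finset.Ioo r (N + 1) = Finset.Ioc r N := by ext; simp
  rw [he] at h
  refine h.trans ?_
  have : (M : ℝ) ≤ r + 1 := by exact_mod_cast hM
  have : (1 : ℝ) ≤ M := by exact_mod_cast hM1
  gcongr

/-! ### Discrete orthogonality -/

/-- Multiplied by $2\sin(m\pi/N)$, which is nonzero for $0<m<N$, the sum telescopes to $\sin(2\pi
m)=0$. -/
lemma sum_cos_odd_eq_zero {N m : ℕ} (hm : 0 < m) (hmN : m < N) :
    ∑ k ∈ Finset.Icc 1 N, Real.cos (m * ((2 * (k : ℝ) - 1) * Real.pi / N)) = 0 := by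
  have hN : (0 : ℝ) < N := by exact_mod_cast hm.trans hmN
  have hm' : (0 : ℝ) < m := by exact_mod_cast hm
  have hmN' : (m : ℝ) < N := by exact_mod_cast hmN
  have hs : Real.sin (m * Real.pi / N) ≠ 0 := by
    refine (Real.sin_pos_of_pos_of_lt_pi (by have := Real.pi_pos; positivity) ?_).ne'
    rw [div_lt_iff₀ hN]
    have := Real.pi_pos
    nlinarith
  have key : ∀ n : ℕ, 2 * Real.sin (m * Real.pi / N) *
      ∑ k ∈ Finset.Icc 1 n, Real.cos (m * ((2 * (k : ℝ) - 1) * Real.pi / N))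
      = Real.sin (2 * n * (m * Real.pi / N)) := by
    intro n
    induction n with
    | zero => simp
    | succ n ih =>
      rw [Finset.sum_Icc_succ_top (by omega), mul_add, ih]
      have h1 : (2 : ℝ) * (n + 1 : ℕ) * (m * Real.pi / N)
        = m * ((2 * ((n + 1 : ℕ) : ℝ) - 1) * Real.pi / N) + m * Real.pi / N := by push_cast; ring
      have h2 : (2 : ℝ) * n * (m * Real.pi / N)
        = m * ((2 * ((n + 1 : ℕ) : ℝ) - 1) * Real.pi / N) - m * Real.pi / N := by push_cast; ring
      rw [h1, h2, Real.sin_add, Real.sin_sub]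
      ring
  have h := key N
  have : (2 : ℝ) * N * (m * Real.pi / N) = m * (2 * Real.pi) := by field_simp
  rw [this] at h
  have h0 : Real.sin (m * (2 * Real.pi)) = 0 := by
    have := Real.sin_nat_mul_pi (2 * m)
    rw [← this]; push_cast; ring_nf
  rw [h0] at h
  simpa [hs] using h

lemma sum_cos_mul_cos_odd {N i j : ℕ} (hi : 0 < i) (hj : 0 < j) (hij : i + j < N) :
    ∑ k ∈ Finset.Icc 1 N, Real.cos (i * ((2 * (k : ℝ) - 1) * Real.pi / N)) *
      Real.cos (j * ((2 * (k : ℝ) - 1) * Real.pi / N)) = if i = j then (N : ℝ) / 2 else 0 := by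
  wlog hle : j ≤ i generalizing i j
  · have := this hj hi (by omega) (by omega)
    simp_rw [mul_comm (Real.cos (j * _))] at this
    rw [this]
    simp [eq_comm]
  have h : ∀ x : ℝ, Real.cos (i * x) * Real.cos (j * x)
      = (Real.cos ((i - j : ℕ) * x) + Real.cos ((i + j : ℕ) * x)) / 2 := by
    intro x
    rw [Nat.cast_sub hle, Nat.cast_add, sub_mul, add_mul, Real.cos_sub, Real.cos_add]
    ring
  simp_rw [h]
  rw [← Finset.sum_div, Finset.sum_add_distrib, sum_cos_odd_eq_zero (m := i + j) (by omega) hij]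
  split_ifs with hij'
  · subst hij'; simp
  · rw [sum_cos_odd_eq_zero (by omega) (by omega)]; simp

/-- A discrete Parseval identity. The condition $2i<N$ keeps $i+j$ below $N$ and so excludes
aliasing. Only $b_i^2$ survives, so random signs in the coefficients disappear. -/
lemma sum_sq_sum_cos_odd {N : ℕ} {s : Finset ℕ} (hs : ∀ i ∈ s, 0 < i ∧ 2 * i < N) (b : ℕ → ℝ) :
    ∑ k ∈ Finset.Icc 1 N, (∑ i ∈ s, b i * Real.cos (i * ((2 * (k : ℝ) - 1) * Real.pi / N))) ^ 2
      = N / 2 * ∑ i ∈ s, b i ^ 2 := by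
  simp_rw [sq, Finset.sum_mul_sum]
  rw [Finset.sum_comm, Finset.mul_sum]
  refine Finset.sum_congr rfl fun i hi => ?_
  rw [Finset.sum_comm]
  have : ∀ j ∈ s, ∑ k ∈ Finset.Icc 1 N, b i * Real.cos (i * ((2 * (k : ℝ) - 1) * Real.pi / N)) *
      (b j * Real.cos (j * ((2 * (k : ℝ) - 1) * Real.pi / N)))
      = if i = j then N / 2 * (b i * b i) else 0 := by
    intro j hj
    have h := sum_cos_mul_cos_odd (hs i hi).1 (hs j hj).1
      (by have := (hs i hi).2; have := (hs j hj).2; omega : i + j < N)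
    have h' : ∀ x : ℝ, b i * Real.cos (i * x) * (b j * Real.cos (j * x))
      = b i * b j * (Real.cos (i * x) * Real.cos (j * x)) := fun x => by ring
    simp_rw [h']
    rw [← Finset.mul_sum, h]
    split_ifs with hij
    · subst hij; ring
    · simp
  rw [Finset.sum_congr rfl this, Finset.sum_ite_eq, if_pos hi]

/-- Concavity puts the sine above its chord from $\pi/4$ to $\pi/2$; rounding $\sqrt2/2$ down to
$0.7$ gives the coefficients. -/
lemma linear_le_sin {x : ℝ} (h1 : 1 / 4 ≤ x) (h2 : x ≤ 1 / 2) :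
    0.4 + 1.2 * x ≤ Real.sin (Real.pi * x) := by
  have hpi := Real.pi_pos
  have hc := strictConcaveOn_sin_Icc.concaveOn.2
    (⟨by positivity, by linarith⟩ : Real.pi / 4 ∈ Set.Icc 0 Real.pi)
    (⟨by positivity, by linarith⟩ : Real.pi / 2 ∈ Set.Icc 0 Real.pi)
    (show 0 ≤ 2 - 4 * x by linarith) (show 0 ≤ 4 * x - 1 by linarith) (by ring)
  simp only [smul_eq_mul, Real.sin_pi_div_four, Real.sin_pi_div_two] at hc
  have he : (2 - 4 * x) * (Real.pi / 4) + (4 * x - 1) * (Real.pi / 2) = Real.pi * x := by ring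
  rw [he] at hc
  have hs : (1.4 : ℝ) ≤ √2 := Real.le_sqrt_of_sq_le (by norm_num)
  nlinarith

/-- A Riemann sum of `sin² (π x) / x²` over `[1/4, 1/2)`. -/
lemma le_sum_sin_sq_div_sq {M : ℕ} (hM : 1 ≤ M) :
    9 / 4 ≤ ((8 * M : ℕ) : ℝ) / 2 * ∑ i ∈ Finset.Ico (2 * M) (4 * M),
      (2 / (i : ℝ) * Real.sin (i * Real.pi / (8 * M : ℕ))) ^ 2 := by
  have hM' : (1 : ℝ) ≤ M := by exact_mod_cast hM
  have hterm : ∀ i ∈ Finset.Ico (2 * M) (4 * M), ∀ c : ℝ, 0 ≤ c →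
      c * (i / (8 * M)) ≤ 0.4 + 1.2 * ((i : ℝ) / (8 * M)) →
      4 * c ^ 2 / (8 * M) ^ 2 ≤ (2 / (i : ℝ) * Real.sin (i * Real.pi / (8 * M : ℕ))) ^ 2 := by
    intro i hi c hc hle
    obtain ⟨hi1, hi2⟩ := Finset.mem_Ico.1 hi
    have hi1' : (2 : ℝ) * M ≤ i := by exact_mod_cast hi1
    have hi2' : (i : ℝ) ≤ 4 * M := by exact_mod_cast hi2.le
    have hi0 : (0 : ℝ) < i := by linarith
    have hs := linear_le_sin (x := (i : ℝ) / (8 * M))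
      (by rw [div_le_div_iff₀ (by norm_num) (by positivity)]; linarith)
      (by rw [div_le_div_iff₀ (by positivity) (by norm_num)]; linarith)
    have he : (i : ℝ) * Real.pi / (8 * M : ℕ) = Real.pi * (i / (8 * M)) := by push_cast; ring
    rw [he]
    have hle' : 2 * c / (8 * M) ≤ 2 / (i : ℝ) * Real.sin (Real.pi * (i / (8 * M))) := by
      calc 2 * c / (8 * M) = 2 / (i : ℝ) * (c * (i / (8 * M))) := by field_simp
        _ ≤ _ := by gcongr; linarith
    calc 4 * c ^ 2 / (8 * M) ^ 2 = (2 * c / (8 * M)) ^ 2 := by ring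
      _ ≤ _ := by gcongr
  -- With $x=i/(8M)$, the bound $\sin(\pi x)\ge 2x$ on the whole range would give exactly $2$ and
  -- leave no room for the error terms. Cutting at $x=3/8$ allows the slope $2.25$ on the first
  -- half, which raises the total above $9/4$.
  rw [← Finset.sum_Ico_consecutive _ (by omega : 2 * M ≤ 3 * M) (by omega : 3 * M ≤ 4 * M)]
  have h1 : (M : ℝ) * (4 * 2.25 ^ 2 / (8 * M) ^ 2) ≤ ∑ i ∈ Finset.Ico (2 * M) (3 * M),
      (2 / (i : ℝ) * Real.sin (i * Real.pi / (8 * M : ℕ))) ^ 2 := by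
    have := Finset.card_nsmul_le_sum (Finset.Ico (2 * M) (3 * M))
      (fun i : ℕ => (2 / (i : ℝ) * Real.sin (i * Real.pi / (8 * M : ℕ))) ^ 2)
      (4 * 2.25 ^ 2 / (8 * M : ℝ) ^ 2) (fun i hi => by
        obtain ⟨hi1, hi2⟩ := Finset.mem_Ico.1 hi
        refine hterm i (Finset.mem_Ico.2 ⟨hi1, by omega⟩) _ (by norm_num) ?_
        have : (i : ℝ) ≤ 3 * M := by exact_mod_cast hi2.le
        have : (i : ℝ) / (8 * M) ≤ 3 / 8 := by
          rw [div_le_div_iff₀ (by positivity) (by norm_num)]; linarith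
        linarith)
    have hc : 3 * M - 2 * M = M := by omega
    simpa [hc] using this
  have h2 : (M : ℝ) * (4 * 2 ^ 2 / (8 * M) ^ 2) ≤ ∑ i ∈ Finset.Ico (3 * M) (4 * M),
      (2 / (i : ℝ) * Real.sin (i * Real.pi / (8 * M : ℕ))) ^ 2 := by
    have := Finset.card_nsmul_le_sum (Finset.Ico (3 * M) (4 * M))
      (fun i : ℕ => (2 / (i : ℝ) * Real.sin (i * Real.pi / (8 * M : ℕ))) ^ 2)
      (4 * 2 ^ 2 / (8 * M : ℝ) ^ 2) (fun i hi => by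
        obtain ⟨hi1, hi2⟩ := Finset.mem_Ico.1 hi
        refine hterm i (Finset.mem_Ico.2 ⟨by omega, hi2⟩) _ (by norm_num) ?_
        have : (i : ℝ) ≤ 4 * M := by exact_mod_cast hi2.le
        have : (i : ℝ) / (8 * M) ≤ 1 / 2 := by
          rw [div_le_div_iff₀ (by positivity) (by norm_num)]; linarith
        linarith)
    have hc : 4 * M - 3 * M = M := by omega
    simpa [hc] using this
  calc (9 / 4 : ℝ) ≤ ((8 * M : ℕ) : ℝ) / 2 * (M * (4 * 2.25 ^ 2 / (8 * M) ^ 2)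
        + M * (4 * 2 ^ 2 / (8 * M) ^ 2)) := by
        push_cast; field_simp; norm_num
    _ ≤ _ := by gcongr

/-! ### The random Fourier series and its second moment -/

/-- Partial sums of the random Fourier series. -/
noncomputable def partialSum {Ω : Type*} (α : ℕ → ℝ) (ε : ℕ → Ω → ℝ) (A : Set ℝ) (N : ℕ) (ω : Ω) : ℝ :=
  ∑ i ∈ Finset.Icc 1 N, α i * ε i ω * ∫ t in A, Real.cos ((i : ℝ) * t)

/-- The sum of the random Fourier series along the dyadic partial sums. -/
noncomputable def fourierMeasure {Ω : Type*} (α : ℕ → ℝ) (ε : ℕ → Ω → ℝ) (A : Set ℝ) (ω : Ω) : ℝ :=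
  limsup (fun p : ℕ => partialSum α ε A (2 ^ p) ω) atTop

lemma tendsto_two_pow : Tendsto (fun p : ℕ => 2 ^ p) atTop (atTop : Filter ℕ) :=
  tendsto_pow_atTop_atTop_of_one_lt (by norm_num)

variable {α : ℕ → ℝ}

omit [MeasurableSpace Ω] in
lemma partialSum_eq (α : ℕ → ℝ) (ε : ℕ → Ω → ℝ) (A : Set ℝ) (N : ℕ) (ω : Ω) :
    partialSum α ε A N ω
      = ∑ i ∈ Finset.Icc 1 N, (α i * ∫ t in A, Real.cos ((i : ℝ) * t)) * ε i ω :=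
  Finset.sum_congr rfl fun i _ => by ring

omit [IsProbabilityMeasure P] in
-- Taking an upper limit instead of a limit makes the sum defined and measurable with no exceptional
-- set.
lemma measurable_fourierMeasure (h : IsBernoulliSequence P ε) (α : ℕ → ℝ) (A : Set ℝ) :
    Measurable (fourierMeasure α ε A) := by
  refine Measurable.limsup fun p => ?_
  exact Finset.measurable_fun_sum _ fun i hi =>
    ((h.measurable i (Finset.mem_Icc.1 hi).1).const_mul _).mul_const _

omit [MeasurableSpace Ω] in
lemma fourierMeasure_eq_of_tendsto {A : Set ℝ} {ω : Ω} {l : ℝ}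
    (hl : Tendsto (fun p : ℕ => partialSum α ε A (2 ^ p) ω) atTop (𝓝 l)) :
    fourierMeasure α ε A ω = l :=
  hl.limsup_eq

lemma sum_coeff_sq_le (hα : ∀ i, |α i| ≤ 1) {A : Set ℝ} (hA : MeasurableSet A)
    (hA' : A ⊆ Set.Icc 0 (2 * Real.pi)) (N : ℕ) :
    ∑ i ∈ Finset.Icc 1 N, (α i * ∫ t in A, Real.cos ((i : ℝ) * t)) ^ 2
      ≤ Real.pi * volume.real A := by
  refine (Finset.sum_le_sum fun i _ => ?_).trans (sum_setIntegral_cos_sq_le hA hA' N)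
  rw [mul_pow]
  exact mul_le_of_le_one_left (sq_nonneg _) ((sq_le_one_iff_abs_le_one _).2 (hα i))

lemma ae_tendsto_partialSum (h : IsBernoulliSequence P ε) (hα : ∀ i, |α i| ≤ 1) {A : Set ℝ}
    (hA : MeasurableSet A) (hA' : A ⊆ Set.Icc 0 (2 * Real.pi)) :
    ∀ᵐ ω ∂P, Tendsto (fun N => partialSum α ε A N ω) atTop (𝓝 (fourierMeasure α ε A ω)) := by
  filter_upwards [h.ae_exists_tendsto _ (sum_coeff_sq_le hα hA hA')] with ω ⟨l, hl⟩
  simp_rw [← partialSum_eq] at hl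
  rwa [fourierMeasure_eq_of_tendsto (hl.comp tendsto_two_pow)]

lemma lintegral_fourierMeasure_sq_le (h : IsBernoulliSequence P ε) (hα : ∀ i, |α i| ≤ 1)
    {A : Set ℝ} (hA : MeasurableSet A) (hA' : A ⊆ Set.Icc 0 (2 * Real.pi)) :
    ∫⁻ ω, ENNReal.ofReal (fourierMeasure α ε A ω ^ 2) ∂P
      ≤ ENNReal.ofReal (Real.pi * volume.real A) := by
  refine h.lintegral_sq_le (N := id) _ (sum_coeff_sq_le hα hA hA') ?_
  filter_upwards [ae_tendsto_partialSum h hα hA hA'] with ω hω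
  simpa only [partialSum_eq, id] using hω

/-! ### Uniform bounds for random trigonometric polynomials -/

/-- Union bound over an equidistant grid. -/
lemma measure_exists_lt_abs_sum_le (h : IsBernoulliSequence P ε) {s : Finset ℕ}
    (hs : ∀ i ∈ s, 1 ≤ i) (φ : ℕ → ℝ → ℝ) {l V x : ℝ}
    (hφ : ∀ i ∈ s, ∀ t u : ℝ, |φ i t - φ i u| ≤ l * |t - u|)
    (hV : ∀ t, ∑ i ∈ s, φ i t ^ 2 ≤ V) (hx : 0 ≤ x) {M : ℕ} (hM : 0 < M) :
    P {ω | ∃ t ∈ Set.Icc 0 (2 * Real.pi), x + s.card * l * (2 * Real.pi / M)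
        < |∑ i ∈ s, φ i t * ε i ω|} ≤ ENNReal.ofReal ((M + 1) * (2 * Real.exp (-x ^ 2 / (2 * V)))) := by
  have hpi := Real.pi_pos
  have hM' : (0 : ℝ) < M := by exact_mod_cast hM
  set τ : ℕ → ℝ := fun k => 2 * Real.pi / M * k
  have hsub : ({ω | ∃ t ∈ Set.Icc 0 (2 * Real.pi), x + s.card * l * (2 * Real.pi / M)
        < |∑ i ∈ s, φ i t * ε i ω|} : Set Ω)
      ≤ᵐ[P] (⋃ k ∈ Finset.range (M + 1), {ω | x ≤ |∑ i ∈ s, φ i (τ k) * ε i ω|} : Set Ω) := by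
    filter_upwards [h.ae_abs_eq_one] with ω hω
    rintro ⟨t, ⟨ht0, ht1⟩, ht⟩
    set k := ⌊t / (2 * Real.pi / M)⌋₊
    have hq : 0 < 2 * Real.pi / M := by positivity
    have hk1 : (k : ℝ) ≤ t / (2 * Real.pi / M) := Nat.floor_le (by positivity)
    have hk2 : t / (2 * Real.pi / M) < k + 1 := Nat.lt_floor_add_one _
    rw [le_div_iff₀ hq] at hk1
    rw [div_lt_iff₀ hq] at hk2
    have hkM : k ≤ M := by
      have : (k : ℝ) * (2 * Real.pi / M) ≤ M * (2 * Real.pi / M) := by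
        rw [mul_div_cancel₀ _ hM'.ne']; linarith
      exact_mod_cast le_of_mul_le_mul_right this hq
    refine Set.mem_biUnion (Finset.mem_range.2 (by omega) : k ∈ Finset.range (M + 1)) ?_
    have hd : |t - τ k| ≤ 2 * Real.pi / M := by
      rw [abs_le]; constructor <;> simp only [τ] <;> nlinarith
    have hdiff : |∑ i ∈ s, φ i t * ε i ω - ∑ i ∈ s, φ i (τ k) * ε i ω|
        ≤ s.card * l * (2 * Real.pi / M) := by
      rw [← Finset.sum_sub_distrib]
      refine (Finset.abs_sum_le_sum_abs _ _).trans ?_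
      rw [mul_assoc, ← nsmul_eq_mul]
      refine Finset.sum_le_card_nsmul _ _ _ fun i hi => ?_
      rw [← sub_mul, abs_mul, hω i (hs i hi), mul_one]
      have h1 := hφ i hi t (τ k)
      have hl : 0 ≤ l := by
        have := (abs_nonneg _).trans (hφ i hi 1 0)
        simpa using this
      exact h1.trans (by gcongr)
    have := abs_sub_abs_le_abs_sub (∑ i ∈ s, φ i t * ε i ω) (∑ i ∈ s, φ i (τ k) * ε i ω)
    change x ≤ |∑ i ∈ s, φ i (τ k) * ε i ω|
    linarith
  refine (measure_mono_ae hsub).trans ((measure_biUnion_finset_le _ _).trans ?_)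
  have : ∀ k ∈ Finset.range (M + 1), P {ω | x ≤ |∑ i ∈ s, φ i (τ k) * ε i ω|}
      ≤ ENNReal.ofReal (2 * Real.exp (-x ^ 2 / (2 * V))) := by
    intro k _
    rw [← ofReal_measureReal]
    exact ENNReal.ofReal_le_ofReal (h.measure_abs_sum_ge_le (fun i => φ i (τ k)) hs (hV _) hx)
  refine (Finset.sum_le_card_nsmul _ _ _ this).trans ?_
  rw [Finset.card_range, nsmul_eq_mul, ENNReal.ofReal_mul (p := (M : ℝ) + 1) (by positivity),
    ← Nat.cast_succ, ENNReal.ofReal_natCast]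

/-- The number of grid points, about $4^p$, times the Hoeffding tail at $2p$ standard deviations.
Since $e^2>4$, a geometric series dominates. -/
lemma summable_grid_bound :
    Summable fun p : ℕ => ((4 ^ p : ℕ) + 1 : ℝ) * (2 * Real.exp (-(2 * (p : ℝ) ^ 2))) := by
  have he : Real.exp (-2) < 1 / 4 := by
    rw [Real.exp_neg, inv_eq_one_div]
    apply one_div_lt_one_div_of_lt (by norm_num)
    have := Real.quadratic_le_exp_of_nonneg (x := 2) (by norm_num)
    linarith
  have hg : Summable fun p : ℕ => 4 * (4 * Real.exp (-2)) ^ p :=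
    (summable_geometric_of_lt_one (by positivity) (by linarith)).mul_left 4
  refine hg.of_nonneg_of_le (fun p => by positivity) fun p => ?_
  have h1 : Real.exp (-(2 * (p : ℝ) ^ 2)) ≤ Real.exp (-2) ^ p := by
    rw [← Real.exp_nat_mul, Real.exp_le_exp]
    have : p ≤ p ^ 2 := Nat.le_self_pow (by norm_num) p
    have : (p : ℝ) ≤ (p : ℝ) ^ 2 := by exact_mod_cast this
    linarith
  have h2 : (1 : ℝ) ≤ 4 ^ p := one_le_pow₀ (by norm_num)
  push_cast
  rw [mul_pow]
  calc ((4 : ℝ) ^ p + 1) * (2 * Real.exp (-(2 * (p : ℝ) ^ 2)))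
      ≤ (4 ^ p + 4 ^ p) * (2 * Real.exp (-2) ^ p) := by gcongr
    _ = _ := by ring

/-- The dyadic block of frequencies `(2 ^ p, 2 ^ (p + 1)]`. -/
abbrev dyadicBlock (p : ℕ) : Finset ℕ := Finset.Ioc (2 ^ p) (2 ^ (p + 1))

lemma card_dyadicBlock (p : ℕ) : (dyadicBlock p).card = 2 ^ p := by
  rw [Nat.card_Ioc, pow_succ]; omega

lemma one_le_of_mem_dyadicBlock {p i : ℕ} (hi : i ∈ dyadicBlock p) : 1 ≤ i :=
  (Nat.zero_le _).trans_lt (Finset.mem_Ioc.1 hi).1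

/-- Almost surely the block polynomials `∑ φ i t * ε i` are eventually uniformly bounded by
`(2 p + 13) σ p`. -/
lemma ae_eventually_abs_block_le (h : IsBernoulliSequence P ε) (φ : ℕ → ℝ → ℝ) (l σ : ℕ → ℝ)
    (hσ : ∀ p, 0 < σ p)
    (hφ : ∀ p, ∀ i ∈ dyadicBlock p, ∀ t u : ℝ, |φ i t - φ i u| ≤ l p * |t - u|)
    (hV : ∀ p t, ∑ i ∈ dyadicBlock p, φ i t ^ 2 ≤ σ p ^ 2)
    (hl : ∀ p, 2 ^ p * l p * (2 * Real.pi / 4 ^ p) ≤ 13 * σ p) :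
    ∀ᵐ ω ∂P, ∀ᶠ p in atTop, ∀ t ∈ Set.Icc 0 (2 * Real.pi),
      |∑ i ∈ dyadicBlock p, φ i t * ε i ω| ≤ (2 * p + 13) * σ p := by
  set E : ℕ → Set Ω := fun p => {ω | ∃ t ∈ Set.Icc 0 (2 * Real.pi),
    (2 * p + 13) * σ p < |∑ i ∈ dyadicBlock p, φ i t * ε i ω|}
  have hE : ∀ p, P (E p) ≤
      ENNReal.ofReal (((4 ^ p : ℕ) + 1 : ℝ) * (2 * Real.exp (-(2 * (p : ℝ) ^ 2)))) := by
    intro p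
    -- The threshold $2p\sigma_p$ produces the tail $e^{-2p^2}$; the remaining $13\sigma_p$ absorbs
    -- the discretisation error of a grid of mesh $2\pi/4^p$.
    have h1 := measure_exists_lt_abs_sum_le h (s := dyadicBlock p)
      (fun i hi => one_le_of_mem_dyadicBlock hi) φ (hφ p) (hV p)
      (x := 2 * p * σ p) (by have := hσ p; positivity) (M := 4 ^ p) (by positivity)
    have he : -(2 * p * σ p) ^ 2 / (2 * σ p ^ 2) = -(2 * (p : ℝ) ^ 2) := by
      have := (hσ p).ne'
      field_simp
    rw [he] at h1
    refine (measure_mono ?_).trans h1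
    rintro ω ⟨t, ht, hlt⟩
    refine ⟨t, ht, lt_of_le_of_lt ?_ hlt⟩
    have := hl p
    rw [card_dyadicBlock]
    push_cast
    linarith
  have hsum : ∑' p, P (E p) ≠ ⊤ :=
    ((ENNReal.tsum_le_tsum hE).trans_lt summable_grid_bound.tsum_ofReal_lt_top).ne
  filter_upwards [ae_eventually_notMem hsum] with ω hω
  filter_upwards [hω] with p hp t ht
  by_contra hlt
  exact hp ⟨t, ht, not_le.1 hlt⟩

lemma abs_sin_mul_div_sub_le {i : ℕ} (hi : 1 ≤ i) (t u : ℝ) :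
    |Real.sin (i * t) / i - Real.sin (i * u) / i| ≤ |t - u| := by
  have hi' : (0 : ℝ) < i := by exact_mod_cast hi
  rw [← sub_div, abs_div, abs_of_pos hi', div_le_iff₀ hi']
  have h := Real.abs_sin_sub_sin_le (i * t) (i * u)
  rw [← mul_sub, abs_mul, abs_of_pos hi'] at h
  linarith

/-- The block has $2^p$ terms, each of variance at most $4^{-p}$, so its standard deviation is at
most $2^{-p/2}$. -/
lemma ae_eventually_sin_block_le (h : IsBernoulliSequence P ε) (hα : ∀ i, |α i| ≤ 1) :
    ∀ᵐ ω ∂P, ∀ᶠ p in atTop, ∀ t ∈ Set.Icc 0 (2 * Real.pi),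
      |∑ i ∈ dyadicBlock p, α i * (Real.sin (i * t) / i) * ε i ω|
        ≤ (2 * p + 13) * (√2 ^ p)⁻¹ := by
  refine ae_eventually_abs_block_le h (fun i t => α i * (Real.sin (i * t) / i)) (fun _ => 1)
    (fun p => (√2 ^ p)⁻¹) (fun p => by positivity) (fun p i hi t u => ?_) (fun p t => ?_) fun p => ?_
  · rw [← mul_sub, abs_mul]
    exact mul_le_mul (hα i) (abs_sin_mul_div_sub_le (one_le_of_mem_dyadicBlock hi) t u)
      (abs_nonneg _) zero_le_one
  · have : ∀ i ∈ dyadicBlock p, (α i * (Real.sin (i * t) / i)) ^ 2 ≤ ((2 ^ p) ^ 2)⁻¹ := by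
      intro i hi
      have hi1 : (2 : ℝ) ^ p ≤ i := by exact_mod_cast (Finset.mem_Ioc.1 hi).1.le
      have h1 : α i ^ 2 ≤ 1 := (sq_le_one_iff_abs_le_one _).2 (hα i)
      have h2 := Real.sin_sq_le_one (i * t)
      rw [mul_pow, div_pow, div_eq_mul_inv]
      calc _ ≤ (1 : ℝ) * (1 * ((i : ℝ) ^ 2)⁻¹) := by gcongr
        _ ≤ _ := by rw [one_mul, one_mul]; gcongr
    refine (Finset.sum_le_card_nsmul _ _ _ this).trans (le_of_eq ?_)
    have h2 : (√2 ^ p) ^ 2 = 2 ^ p := by rw [← pow_mul, mul_comm p 2, pow_mul, Real.sq_sqrt (by norm_num)]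
    rw [card_dyadicBlock, nsmul_eq_mul, inv_pow, h2]
    push_cast
    field_simp
  · have h2 : (√2 ^ p) * (√2 ^ p) = 2 ^ p := by rw [← mul_pow, Real.mul_self_sqrt (by norm_num)]
    have h4 : (4 : ℝ) ^ p = 2 ^ p * 2 ^ p := by rw [← mul_pow]; norm_num
    have h1 : (1 : ℝ) ≤ √2 ^ p := one_le_pow₀ (Real.one_le_sqrt.2 (by norm_num))
    have hp := Real.pi_lt_d2
    rw [h4, ← h2, mul_one]
    set R := √2 ^ p
    have hR : 0 < R := by positivity
    field_simp
    nlinarith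

/-- This controls the derivative of the sine block. The grid error is $4\pi$ here, whence the
constant $13$. -/
lemma ae_eventually_cos_block_le (h : IsBernoulliSequence P ε) (hα : ∀ i, |α i| ≤ 1) :
    ∀ᵐ ω ∂P, ∀ᶠ p in atTop, ∀ t ∈ Set.Icc 0 (2 * Real.pi),
      |∑ i ∈ dyadicBlock p, α i * Real.cos (i * t) * ε i ω| ≤ (2 * p + 13) * √2 ^ p := by
  refine ae_eventually_abs_block_le h (fun i t => α i * Real.cos (i * t)) (fun p => 2 ^ (p + 1))
    (fun p => √2 ^ p) (fun p => by positivity) (fun p i hi t u => ?_) (fun p t => ?_) fun p => ?_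
  · have hi1 : (i : ℝ) ≤ 2 ^ (p + 1) := by exact_mod_cast (Finset.mem_Ioc.1 hi).2
    have h1 := Real.abs_cos_sub_cos_le (i * t) (i * u)
    rw [← mul_sub, abs_mul (i : ℝ), Nat.abs_cast] at h1
    rw [← mul_sub, abs_mul]
    calc _ ≤ 1 * ((i : ℝ) * |t - u|) := mul_le_mul (hα i) h1 (abs_nonneg _) zero_le_one
      _ ≤ _ := by rw [one_mul]; gcongr
  · have : ∀ i ∈ dyadicBlock p, (α i * Real.cos (i * t)) ^ 2 ≤ 1 := by
      intro i hi
      rw [mul_pow]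
      exact mul_le_one₀ ((sq_le_one_iff_abs_le_one _).2 (hα i)) (sq_nonneg _)
        (Real.cos_sq_le_one _)
    refine (Finset.sum_le_card_nsmul _ _ _ this).trans (le_of_eq ?_)
    rw [card_dyadicBlock, nsmul_eq_mul, ← pow_mul, mul_comm p 2, pow_mul √2,
      Real.sq_sqrt (by norm_num)]
    push_cast
    ring
  · have h4 : (4 : ℝ) ^ p = 2 ^ p * 2 ^ p := by rw [← mul_pow]; norm_num
    have h1 : (1 : ℝ) ≤ √2 ^ p := one_le_pow₀ (Real.one_le_sqrt.2 (by norm_num))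
    have hp := Real.pi_lt_d2
    rw [h4, pow_succ]
    have : (2 : ℝ) ^ p * (2 ^ p * 2) * (2 * Real.pi / (2 ^ p * 2 ^ p)) = 4 * Real.pi := by
      field_simp
      norm_num
    rw [this]
    linarith

/-! ### Hölder continuity of the path -/

/-- Writing $x=x^{1-\gamma}x^{\gamma}$, the sup bound is used on the first factor and the Lipschitz
bound on the second. With $R=2^{p/2}$ the power $R^{2\gamma-1}$ decays geometrically in $p$ when
$\gamma<1/2$. -/
lemma le_of_le_of_le_interpolation {x a R d γ : ℝ} (hx : 0 ≤ x) (ha : 0 ≤ a) (hR : 0 < R)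
    (hd : 0 ≤ d) (hγ0 : 0 ≤ γ) (hγ1 : γ ≤ 1) (h1 : x ≤ 2 * a * R⁻¹) (h2 : x ≤ a * R * d) :
    x ≤ 2 * a * R ^ (2 * γ - 1) * d ^ γ := by
  rcases hx.eq_or_lt with rfl | hx
  · positivity
  have ha' : 0 < a := by
    rcases ha.eq_or_lt with rfl | ha
    · simp at h1; linarith
    · exact ha
  calc x = x ^ (1 - γ) * x ^ γ := by rw [← Real.rpow_add hx]; simp
    _ ≤ (2 * a * R⁻¹) ^ (1 - γ) * (2 * a * R * d) ^ γ := by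
        gcongr
        refine h2.trans ?_
        have : 0 ≤ a * R * d := by positivity
        linarith
    _ = _ := by
        rw [Real.mul_rpow (x := 2 * a) (by positivity) (by positivity),
          Real.mul_rpow (x := 2 * a * R) (by positivity) hd,
          Real.mul_rpow (x := 2 * a) (by positivity) hR.le, Real.inv_rpow hR.le,
          ← Real.rpow_neg hR.le]
        have e1 : (2 * a) ^ (1 - γ) * (2 * a) ^ γ = 2 * a := by
          rw [← Real.rpow_add (by positivity)]; simp
        have e2 : R ^ (-(1 - γ)) * R ^ γ = R ^ (2 * γ - 1) := by
          rw [← Real.rpow_add hR]; ring_nf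
        calc _ = ((2 * a) ^ (1 - γ) * (2 * a) ^ γ) * (R ^ (-(1 - γ)) * R ^ γ) * d ^ γ := by ring
          _ = _ := by rw [e1, e2]

/-- The block bounds hold only from a random index `p₀` on; `L` accounts for everything before it.
-/
lemma abs_sub_le_of_telescope {T : ℕ → ℝ → ℝ} {F : ℝ → ℝ} {s t L d : ℝ} {p₀ : ℕ} {b : ℕ → ℝ}
    (hb : Summable b) (hb0 : ∀ p, 0 ≤ b p) (hd : 0 ≤ d)
    (hs : Tendsto (fun p => T p s) atTop (𝓝 (F s))) (ht : Tendsto (fun p => T p t) atTop (𝓝 (F t)))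
    (h0 : |T p₀ t - T p₀ s| ≤ L * d)
    (hstep : ∀ p, p₀ ≤ p → |(T (p + 1) t - T p t) - (T (p + 1) s - T p s)| ≤ b p * d) :
    |F t - F s| ≤ (L + ∑' p, b p) * d := by
  refine le_of_tendsto (ht.sub hs).abs (eventually_atTop.2 ⟨p₀, fun p hp => ?_⟩)
  have key : |T p t - T p s| ≤ (L + ∑ q ∈ Finset.Ico p₀ p, b q) * d := by
    induction p, hp using Nat.le_induction with
    | base => simpa using h0
    | succ p hp ih =>
      rw [Finset.sum_Ico_succ_top hp, ← add_assoc, add_mul]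
      calc |T (p + 1) t - T (p + 1) s|
          = |(T p t - T p s) + ((T (p + 1) t - T p t) - (T (p + 1) s - T p s))| := by ring_nf
        _ ≤ _ := (abs_add_le _ _).trans (add_le_add ih (hstep p hp))
  refine key.trans ?_
  gcongr
  exact hb.sum_le_tsum _ fun q _ => hb0 q

lemma summable_linear_mul_geometric {r : ℝ} (hr0 : 0 ≤ r) (hr : r < 1) :
    Summable fun p : ℕ => (2 * (p : ℝ) + 13) * r ^ p := by
  have h1 := summable_pow_mul_geometric_of_norm_lt_one 1 (r := r) (by rwa [Real.norm_of_nonneg hr0])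
  have h2 := summable_geometric_of_lt_one hr0 hr
  refine ((h1.mul_left 2).add (h2.mul_left 13)).congr fun p => ?_
  ring

omit [MeasurableSpace Ω] in
lemma partialSum_Ioc (α : ℕ → ℝ) (ε : ℕ → Ω → ℝ) {t : ℝ} (ht : 0 ≤ t) (N : ℕ) (ω : Ω) :
    partialSum α ε (Set.Ioc 0 t) N ω
      = ∑ i ∈ Finset.Icc 1 N, α i * (Real.sin (i * t) / i) * ε i ω := by
  refine Finset.sum_congr rfl fun i hi => ?_
  rw [setIntegral_cos_Ioc (Finset.mem_Icc.1 hi).1 ht]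
  simp only [mul_zero, Real.sin_zero, sub_zero]
  ring

lemma sum_Icc_two_pow_succ (f : ℕ → ℝ) (p : ℕ) :
    ∑ i ∈ Finset.Icc 1 (2 ^ (p + 1)), f i
      = ∑ i ∈ Finset.Icc 1 (2 ^ p), f i + ∑ i ∈ dyadicBlock p, f i := by
  have h : Finset.Icc 1 (2 ^ p) = Finset.Ioc 0 (2 ^ p) := rfl
  have h' : Finset.Icc 1 (2 ^ (p + 1)) = Finset.Ioc 0 (2 ^ (p + 1)) := rfl
  rw [h, h', Finset.sum_Ioc_consecutive _ (Nat.zero_le _) (Nat.pow_le_pow_right (by norm_num) (by omega))]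

lemma abs_sin_sum_sub_le {s : Finset ℕ} (hs : ∀ i ∈ s, 1 ≤ i) (a : ℕ → ℝ) {C : ℝ}
    (hC : ∀ t ∈ Set.Icc 0 (2 * Real.pi), |∑ i ∈ s, a i * Real.cos (i * t)| ≤ C) {t u : ℝ}
    (ht : t ∈ Set.Icc 0 (2 * Real.pi)) (hu : u ∈ Set.Icc 0 (2 * Real.pi)) :
    |∑ i ∈ s, a i * (Real.sin (i * t) / i) - ∑ i ∈ s, a i * (Real.sin (i * u) / i)|
      ≤ C * |t - u| := by
  have hder : ∀ x ∈ Set.Icc 0 (2 * Real.pi), HasDerivWithinAt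
      (fun x => ∑ i ∈ s, a i * (Real.sin (i * x) / i)) (∑ i ∈ s, a i * Real.cos (i * x))
      (Set.Icc 0 (2 * Real.pi)) x := by
    intro x _
    refine HasDerivAt.hasDerivWithinAt (HasDerivAt.fun_sum fun i hi => ?_)
    have hi' : (i : ℝ) ≠ 0 := by have := hs i hi; positivity
    have := ((((hasDerivAt_id x).const_mul (i : ℝ)).sin).div_const (i : ℝ)).const_mul (a i)
    refine this.congr_deriv ?_
    simp only [id]
    field_simp
  exact (convex_Icc _ _).norm_image_sub_le_of_norm_hasDerivWithin_le hder
    (fun x hx => hC x hx) hu ht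

/-- Almost surely the path of a random Fourier series with bounded coefficients is Hölder
continuous with every exponent less than `1 / 2`. -/
theorem ae_holderOnWith_path (h : IsBernoulliSequence P ε) (hα : ∀ i, |α i| ≤ 1) :
    ∀ᵐ ω ∂P, ∀ γ : ℝ≥0, γ < 1 / 2 → ∃ C : ℝ≥0,
      HolderOnWith C γ (fun t => path (fourierMeasure α ε) t ω) (Set.Icc 0 (2 * Real.pi)) := by
  filter_upwards [ae_eventually_sin_block_le h hα, ae_eventually_cos_block_le h hα,
    h.ae_abs_eq_one] with ω hF hG hε γ hγ
  have hγ' : (γ : ℝ) < 1 / 2 := by exact_mod_cast hγ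
  have hs2 : 1 < √2 := by rw [Real.lt_sqrt (by norm_num)]; norm_num
  set I := Set.Icc 0 (2 * Real.pi)
  set T : ℕ → ℝ → ℝ := fun p t => ∑ i ∈ Finset.Icc 1 (2 ^ p), α i * (Real.sin (i * t) / i) * ε i ω
  have hT1 : ∀ p t, T (p + 1) t - T p t
      = ∑ i ∈ dyadicBlock p, α i * (Real.sin (i * t) / i) * ε i ω := by
    intro p t
    simp only [T]
    rw [sum_Icc_two_pow_succ]
    ring
  set F : ℝ → ℝ := fun t => path (fourierMeasure α ε) t ω
  -- The block bounds are uniform in `t`, so one null set serves all `t`. This is why the measure is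
  -- defined through dyadic partial sums.
  have hT : ∀ t ∈ I, Tendsto (fun p => T p t) atTop (𝓝 (F t)) := by
    intro t ht
    have hsum : Summable fun p => T (p + 1) t - T p t := by
      refine Summable.of_norm_bounded_eventually_nat (summable_linear_mul_geometric
        (r := (√2)⁻¹) (by positivity) (inv_lt_one_of_one_lt₀ hs2)) ?_
      filter_upwards [hF] with p hp
      rw [hT1, inv_pow]
      exact hp t ht
    have hlim : Tendsto (fun p => T p t) atTop (𝓝 (∑' p, (T (p + 1) t - T p t) + T 0 t)) := by
      refine (hsum.hasSum.tendsto_sum_nat.add_const (T 0 t)).congr fun p => ?_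
      rw [Finset.sum_range_sub (fun p => T p t)]
      ring
    have : F t = ∑' p, (T (p + 1) t - T p t) + T 0 t := by
      refine fourierMeasure_eq_of_tendsto (hlim.congr fun p => ?_)
      rw [partialSum_Ioc α ε ht.1]
    rwa [this]
  set r : ℝ := √2 ^ (2 * (γ : ℝ) - 1)
  have hr0 : 0 ≤ r := by positivity
  have hr1 : r < 1 := Real.rpow_lt_one_of_one_lt_of_neg hs2 (by linarith)
  have hsumr := (summable_linear_mul_geometric hr0 hr1).mul_left 2
  obtain ⟨p₀, hp₀⟩ := eventually_atTop.1 (hF.and hG)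
  -- Each of the first $2^{p_0}$ terms is 1-Lipschitz, and $|t-s|\le(2\pi)^{1-\gamma}|t-s|^\gamma$
  -- on the interval.
  set L : ℝ := 2 ^ p₀ * (2 * Real.pi) ^ (1 - (γ : ℝ))
  have hL : 0 ≤ L := by have := Real.pi_pos; positivity
  have hmain : ∀ s ∈ I, ∀ t ∈ I, |F t - F s|
      ≤ (L + ∑' p : ℕ, 2 * ((2 * (p : ℝ) + 13) * r ^ p)) * |t - s| ^ (γ : ℝ) := by
    intro s hs t ht
    refine abs_sub_le_of_telescope (p₀ := p₀) hsumr (fun p => by positivity) (by positivity)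
      (hT s hs) (hT t ht) ?_ fun p hp => ?_
    · have h1 : |T p₀ t - T p₀ s| ≤ 2 ^ p₀ * |t - s| := by
        simp only [T]
        rw [← Finset.sum_sub_distrib]
        refine (Finset.abs_sum_le_sum_abs _ _).trans ?_
        have : ∀ i ∈ Finset.Icc 1 (2 ^ p₀), |α i * (Real.sin (i * t) / i) * ε i ω
            - α i * (Real.sin (i * s) / i) * ε i ω| ≤ |t - s| := by
          intro i hi
          have hi1 := (Finset.mem_Icc.1 hi).1
          rw [← sub_mul, abs_mul, hε i hi1, mul_one, ← mul_sub, abs_mul]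
          exact (mul_le_of_le_one_left (abs_nonneg _) (hα i)).trans
            (abs_sin_mul_div_sub_le hi1 t s)
        refine (Finset.sum_le_card_nsmul _ _ _ this).trans ?_
        simp
      refine h1.trans ?_
      rw [mul_assoc]
      gcongr
      have hd : |t - s| ≤ 2 * Real.pi := by
        rw [abs_le]; constructor <;> linarith [ht.1, ht.2, hs.1, hs.2]
      rcases (abs_nonneg (t - s)).eq_or_lt with h0 | h0
      · rw [← h0]; have := Real.pi_pos; positivity
      · calc |t - s| = |t - s| ^ (1 - (γ : ℝ)) * |t - s| ^ (γ : ℝ) := by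
              rw [← Real.rpow_add h0]; simp
          _ ≤ _ := by
              gcongr
              linarith
    · obtain ⟨hFp, hGp⟩ := hp₀ p hp
      rw [hT1, hT1]
      have hR : 0 < √2 ^ p := by positivity
      have h1 := le_of_le_of_le_interpolation (a := 2 * p + 13) (R := √2 ^ p) (d := |t - s|)
        (γ := γ) (abs_nonneg (∑ i ∈ dyadicBlock p, α i * (Real.sin (i * t) / i) * ε i ω
          - ∑ i ∈ dyadicBlock p, α i * (Real.sin (i * s) / i) * ε i ω)) (by positivity) hR
        (abs_nonneg _) γ.2 (by linarith) ?_ ?_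
      · refine h1.trans (le_of_eq ?_)
        rw [← Real.rpow_natCast √2 p, ← Real.rpow_mul (by positivity), mul_comm (p : ℝ),
          Real.rpow_mul (by positivity), Real.rpow_natCast]
        ring
      · refine (abs_sub _ _).trans ?_
        have := hFp t ht
        have := hFp s hs
        linarith
      · have hs1 : ∀ x : ℝ, ∑ i ∈ dyadicBlock p, α i * (Real.sin (i * x) / i) * ε i ω
            = ∑ i ∈ dyadicBlock p, (α i * ε i ω) * (Real.sin (i * x) / i) := fun x =>
          Finset.sum_congr rfl fun i _ => by ring
        rw [hs1, hs1]
        refine abs_sin_sum_sub_le (fun i hi => one_le_of_mem_dyadicBlock hi) _ (fun x hx => ?_) ht hs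
        refine le_of_eq_of_le ?_ (hGp x hx)
        congr 1
        exact Finset.sum_congr rfl fun i _ => by ring
  set K : ℝ := L + ∑' p : ℕ, 2 * ((2 * (p : ℝ) + 13) * r ^ p)
  have hK : 0 ≤ K := add_nonneg hL (tsum_nonneg fun p => by positivity)
  refine ⟨K.toNNReal, fun s hs t ht => ?_⟩
  rw [edist_dist, edist_dist, dist_comm, dist_comm s t, Real.dist_eq, Real.dist_eq,
    ENNReal.ofReal_rpow_of_nonneg (abs_nonneg (t - s)) γ.coe_nonneg]
  change _ ≤ ENNReal.ofReal K * _
  rw [← ENNReal.ofReal_mul hK]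
  exact ENNReal.ofReal_le_ofReal (hmain s hs t ht)

/-! ### The random Fourier series is a stochastic measure -/

lemma fourierMeasure_union (h : IsBernoulliSequence P ε) (hα : ∀ i, |α i| ≤ 1) {A B : Set ℝ}
    (hA : MeasurableSet A) (hA' : A ⊆ Set.Icc 0 (2 * Real.pi)) (hB : MeasurableSet B)
    (hB' : B ⊆ Set.Icc 0 (2 * Real.pi)) (hd : Disjoint A B) :
    ∀ᵐ ω ∂P, fourierMeasure α ε (A ∪ B) ω = fourierMeasure α ε A ω + fourierMeasure α ε B ω := by
  filter_upwards [ae_tendsto_partialSum h hα hA hA', ae_tendsto_partialSum h hα hB hB',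
    ae_tendsto_partialSum h hα (hA.union hB) (Set.union_subset hA' hB')] with ω h1 h2 h3
  refine tendsto_nhds_unique h3 ((h1.add h2).congr fun N => ?_)
  rw [partialSum, partialSum, partialSum, ← Finset.sum_add_distrib]
  refine Finset.sum_congr rfl fun i _ => ?_
  rw [setIntegral_union hd hB (integrable_cos_restrict hA' i) (integrable_cos_restrict hB' i)]
  ring

/-- By finite additivity the error after `N` terms is the measure of the tail union `B N`. Its
second moment is at most $\pi|B_N|\to0$, and Chebyshev's inequality concludes. -/
theorem isStochasticMeasureOn_fourierMeasure (h : IsBernoulliSequence P ε)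
    (hα : ∀ i, |α i| ≤ 1) :
    IsStochasticMeasureOn P (Set.Icc 0 (2 * Real.pi)) (fourierMeasure α ε) where
  measurable A _ _ := measurable_fourierMeasure h α A
  sigma_additive A hA hA' hd := by
    set B : ℕ → Set ℝ := fun N => ⋃ i ≥ N, A i
    have hBm : ∀ N, MeasurableSet (B N) := fun N =>
      MeasurableSet.iUnion fun i => MeasurableSet.iUnion fun _ => hA i
    have hB' : ∀ N, B N ⊆ Set.Icc 0 (2 * Real.pi) := fun N =>
      Set.iUnion_subset fun i => Set.iUnion_subset fun _ => hA' i
    have hB0 : ⋃ i, A i = B 0 := by simp [B]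
    have hBs : ∀ N, B N = A N ∪ B (N + 1) := by
      intro N
      ext x
      simp only [B, Set.mem_iUnion, Set.mem_union, exists_prop]
      constructor
      · rintro ⟨i, hi, hx⟩
        rcases hi.eq_or_lt with rfl | hi
        · exact Or.inl hx
        · exact Or.inr ⟨i, hi, hx⟩
      · rintro (hx | ⟨i, hi, hx⟩)
        · exact ⟨N, le_rfl, hx⟩
        · exact ⟨i, (Nat.le_succ N).trans hi, hx⟩
    have hBd : ∀ N, Disjoint (A N) (B (N + 1)) := fun N =>
      Set.disjoint_iUnion₂_right.2 fun i hi => hd (by have : N + 1 ≤ i := hi; omega)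
    have hrem : ∀ᵐ ω ∂P, ∀ N, ∑ i ∈ Finset.range N, fourierMeasure α ε (A i) ω
        + fourierMeasure α ε (B N) ω = fourierMeasure α ε (⋃ i, A i) ω := by
      have hstep : ∀ᵐ ω ∂P, ∀ N, fourierMeasure α ε (B N) ω
          = fourierMeasure α ε (A N) ω + fourierMeasure α ε (B (N + 1)) ω := by
        rw [ae_all_iff]
        intro N
        rw [hBs N]
        exact fourierMeasure_union h hα (hA N) (hA' N) (hBm _) (hB' _) (hBd N)
      filter_upwards [hstep] with ω hω N
      induction N with
      | zero => simp [hB0]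
      | succ N ih => rw [Finset.sum_range_succ, ← ih, hω N]; ring
    have hvol : Tendsto (fun N => volume.real (B N)) atTop (𝓝 0) := by
      have := tendsto_measure_biUnion_Ici_zero_of_pairwise_disjoint
        (μ := volume.restrict (Set.Icc 0 (2 * Real.pi)))
        (fun i => (hA i).nullMeasurableSet) hd
      have h2 := (ENNReal.tendsto_toReal ENNReal.zero_ne_top).comp this
      refine h2.congr fun N => ?_
      change ((volume.restrict (Set.Icc 0 (2 * Real.pi))) (B N)).toReal = _
      rw [Measure.restrict_apply (hBm N), Set.inter_eq_self_of_subset_left (hB' N)]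
      rfl
    rw [tendstoInMeasure_iff_norm]
    intro η hη
    have hbound : ∀ N, P {ω | η ≤ ‖∑ i ∈ Finset.range N, fourierMeasure α ε (A i) ω
        - fourierMeasure α ε (⋃ i, A i) ω‖}
        ≤ ENNReal.ofReal (Real.pi * volume.real (B N)) / ENNReal.ofReal (η ^ 2) := by
      intro N
      have hη2 : 0 < η ^ 2 := by positivity
      calc P {ω | η ≤ ‖∑ i ∈ Finset.range N, fourierMeasure α ε (A i) ω
            - fourierMeasure α ε (⋃ i, A i) ω‖}
          ≤ P {ω | ENNReal.ofReal (η ^ 2) ≤ ENNReal.ofReal (fourierMeasure α ε (B N) ω ^ 2)} := by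
            refine measure_mono_ae ?_
            filter_upwards [hrem] with ω hω hω'
            refine ENNReal.ofReal_le_ofReal ?_
            have h1 : η ≤ ‖∑ i ∈ Finset.range N, fourierMeasure α ε (A i) ω
              - fourierMeasure α ε (⋃ i, A i) ω‖ := hω'
            rw [← hω N, sub_add_cancel_left, norm_neg, Real.norm_eq_abs] at h1
            rw [← sq_abs (fourierMeasure α ε (B N) ω)]
            gcongr
        _ ≤ _ := (meas_ge_le_lintegral_div
            ((measurable_fourierMeasure h α (B N)).pow_const 2).ennreal_ofReal.aemeasurable
            (by simpa using hη.ne') ENNReal.ofReal_ne_top).trans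
            (ENNReal.div_le_div_right
              (lintegral_fourierMeasure_sq_le h hα (hBm N) (hB' N)) _)
    have hz : Tendsto (fun N => ENNReal.ofReal (Real.pi * volume.real (B N))
        / ENNReal.ofReal (η ^ 2)) atTop (𝓝 0) := by
      have h1 := ENNReal.tendsto_ofReal (hvol.const_mul Real.pi)
      have h2 := ENNReal.Tendsto.div_const (b := ENNReal.ofReal (η ^ 2)) h1
        (Or.inr (by simpa using hη.ne'))
      simpa using h2
    exact tendsto_of_tendsto_of_tendsto_of_le_of_le tendsto_const_nhds hz
      (fun _ => zero_le) hbound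

/-! ### Dyadic increments -/

lemma dyadicPoint_nonneg (n k : ℕ) : 0 ≤ dyadicPoint n k := by
  have := Real.pi_pos
  unfold dyadicPoint
  positivity

lemma dyadicPoint_mono (n : ℕ) {k l : ℕ} (hkl : k ≤ l) : dyadicPoint n k ≤ dyadicPoint n l := by
  have := Real.pi_pos
  have : (k : ℝ) ≤ l := by exact_mod_cast hkl
  unfold dyadicPoint
  gcongr

lemma dyadicPoint_two_pow (n : ℕ) : dyadicPoint n (2 ^ n) = 2 * Real.pi := by
  unfold dyadicPoint
  push_cast
  field_simp

lemma dyadicPoint_zero (n : ℕ) : dyadicPoint n 0 = 0 := by simp [dyadicPoint]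

lemma dyadicPoint_le (n : ℕ) {k : ℕ} (hk : k ≤ 2 ^ n) : dyadicPoint n k ≤ 2 * Real.pi :=
  (dyadicPoint_mono n hk).trans_eq (dyadicPoint_two_pow n)

lemma dyadicPoint_sub (n : ℕ) {k : ℕ} (hk : 1 ≤ k) :
    dyadicPoint n k - dyadicPoint n (k - 1) = 2 * Real.pi / 2 ^ n := by
  unfold dyadicPoint
  rw [Nat.cast_sub hk]
  push_cast
  ring

lemma measurableSet_dyadicInterval (n k : ℕ) : MeasurableSet (dyadicInterval n k) :=
  measurableSet_Ioc

lemma dyadicInterval_subset {n k : ℕ} (hk : k ≤ 2 ^ n) :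
    dyadicInterval n k ⊆ Set.Icc 0 (2 * Real.pi) := fun _ hx =>
  ⟨(dyadicPoint_nonneg _ _).trans hx.1.le, hx.2.trans (dyadicPoint_le n hk)⟩

/-- Sum of squares of the remainders of the dyadic increments after the first `r` frequencies. -/
noncomputable def remainderSum (α : ℕ → ℝ) (ε : ℕ → Ω → ℝ) (n r : ℕ) (ω : Ω) : ℝ :=
  ∑ k ∈ Finset.Icc 1 (2 ^ n),
    (fourierMeasure α ε (dyadicInterval n k) ω - partialSum α ε (dyadicInterval n k) r ω) ^ 2

/-- Because of the gap, only frequencies $i\ge M$ remain. Their squared coefficients are at most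
$4/i^2$, with sum at most $8/M$. -/
lemma lintegral_remainder_sq_le (h : IsBernoulliSequence P ε) (hα : ∀ i, |α i| ≤ 1)
    {n k r M : ℕ} (hk : k ≤ 2 ^ n) (hM : 1 ≤ M)
    (hgap : ∀ i, r < i → i < M → α i = 0) :
    ∫⁻ ω, ENNReal.ofReal ((fourierMeasure α ε (dyadicInterval n k) ω
      - partialSum α ε (dyadicInterval n k) r ω) ^ 2) ∂P ≤ ENNReal.ofReal (8 / M) := by
  set c : ℕ → ℝ := fun i => ∫ t in dyadicInterval n k, Real.cos ((i : ℝ) * t)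
  set a : ℕ → ℝ := fun i => if i ≤ r then 0 else α i * c i
  refine h.lintegral_sq_le (N := id) a (fun N => ?_) ?_
  · calc ∑ i ∈ Finset.Icc 1 N, a i ^ 2
        ≤ ∑ i ∈ Finset.Icc 1 N, if M - 1 < i then 4 * ((i : ℝ) ^ 2)⁻¹ else 0 := by
          refine Finset.sum_le_sum fun i hi => ?_
          simp only [a]
          split_ifs with h1 h2 h2
          · norm_num
          · simp
          · rw [mul_pow]
            exact (mul_le_of_le_one_left (sq_nonneg _)
              ((sq_le_one_iff_abs_le_one _).2 (hα i))).trans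
              (setIntegral_cos_Ioc_sq_le (Finset.mem_Icc.1 hi).1 (dyadicPoint_mono n (Nat.sub_le k 1)))
          · rw [hgap i (by omega) (by omega)]; simp
      _ = ∑ i ∈ Finset.Ioc (M - 1) N, 4 * ((i : ℝ) ^ 2)⁻¹ := by
          rw [← Finset.sum_filter]
          congr 1
          ext i
          simp only [Finset.mem_filter, Finset.mem_Icc, Finset.mem_Ioc]
          omega
      _ ≤ 8 / M := by
          rw [← Finset.mul_sum]
          have := sum_Ioc_inv_sq_le' (M := M) (M - 1) N (by omega) hM
          calc _ ≤ 4 * (2 / (M : ℝ)) := by gcongr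
            _ = _ := by ring
  · filter_upwards [ae_tendsto_partialSum h hα (measurableSet_dyadicInterval n k)
      (dyadicInterval_subset hk)] with ω hω
    refine (hω.sub_const (partialSum α ε (dyadicInterval n k) r ω)).congr' ?_
    filter_upwards [eventually_ge_atTop r] with N hN
    rw [partialSum_eq, partialSum_eq, sub_eq_iff_eq_add, id]
    have hsub : Finset.Icc 1 r = (Finset.Icc 1 N).filter (· ≤ r) := by
      ext i
      simp only [Finset.mem_filter, Finset.mem_Icc]
      omega
    rw [hsub, Finset.sum_filter, ← Finset.sum_add_distrib]
    refine Finset.sum_congr rfl fun i _ => ?_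
    simp only [a]
    split_ifs <;> simp [c]

lemma measure_le_remainderSum_le (h : IsBernoulliSequence P ε) (hα : ∀ i, |α i| ≤ 1)
    {n r M : ℕ} (hM : 1 ≤ M) (hgap : ∀ i, r < i → i < M → α i = 0) {η : ℝ} (hη : 0 < η) :
    P {ω | η ≤ remainderSum α ε n r ω} ≤ ENNReal.ofReal (2 ^ n * (8 / M) / η) := by
  have hmeas : ∀ k, Measurable fun ω => (fourierMeasure α ε (dyadicInterval n k) ω
      - partialSum α ε (dyadicInterval n k) r ω) ^ 2 := fun k =>
    ((measurable_fourierMeasure h α _).sub (Finset.measurable_fun_sum _ fun i hi =>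
      ((h.measurable i (Finset.mem_Icc.1 hi).1).const_mul _).mul_const _)).pow_const 2
  have hsum : ∫⁻ ω, ENNReal.ofReal (remainderSum α ε n r ω) ∂P
      ≤ ENNReal.ofReal (2 ^ n * (8 / M)) := by
    simp only [remainderSum]
    simp_rw [ENNReal.ofReal_sum_of_nonneg fun i _ => sq_nonneg _]
    rw [lintegral_finsetSum _ fun k _ => (hmeas k).ennreal_ofReal]
    refine (Finset.sum_le_card_nsmul _ _ _ fun k hk => lintegral_remainder_sq_le h hα
      (Finset.mem_Icc.1 hk).2 hM hgap).trans (le_of_eq ?_)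
    rw [Nat.card_Icc, Nat.add_sub_cancel, nsmul_eq_mul, ENNReal.ofReal_mul (by positivity),
      ← ENNReal.ofReal_natCast]
    push_cast
    rfl
  calc P {ω | η ≤ remainderSum α ε n r ω}
      ≤ P {ω | ENNReal.ofReal η ≤ ENNReal.ofReal (remainderSum α ε n r ω)} :=
        measure_mono fun ω (hω : η ≤ _) => ENNReal.ofReal_le_ofReal hω
    _ ≤ (∫⁻ ω, ENNReal.ofReal (remainderSum α ε n r ω) ∂P) / ENNReal.ofReal η :=
        meas_ge_le_lintegral_div
          (Finset.measurable_fun_sum _ fun k _ => hmeas k).ennreal_ofReal.aemeasurable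
          (by simpa using hη) ENNReal.ofReal_ne_top
    _ ≤ ENNReal.ofReal (2 ^ n * (8 / M)) / ENNReal.ofReal η := ENNReal.div_le_div_right hsum _
    _ = _ := (ENNReal.ofReal_div_of_pos hη).symm

omit [MeasurableSpace Ω] in
/-- Low frequencies contribute little to the dyadic sum of squares. -/
lemma sum_partialSum_sq_le (hα : ∀ i, |α i| ≤ 1) {ω : Ω} (hε : ∀ i, 1 ≤ i → |ε i ω| = 1)
    {n q r : ℕ} (hgap : ∀ i, 2 ^ q ≤ i → i ≤ r → α i = 0) (hq : 2 * q + 16 ≤ n) :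
    ∑ k ∈ Finset.Icc 1 (2 ^ n), partialSum α ε (dyadicInterval n k) r ω ^ 2 ≤ 1 / 2 ^ 10 := by
  have hpi := Real.pi_pos
  have hterm : ∀ k ∈ Finset.Icc 1 (2 ^ n), partialSum α ε (dyadicInterval n k) r ω ^ 2
      ≤ (2 ^ q * (2 * Real.pi / 2 ^ n)) ^ 2 := by
    intro k hk
    have hk1 := (Finset.mem_Icc.1 hk).1
    rw [← sq_abs]
    refine pow_le_pow_left₀ (abs_nonneg _) ?_ 2
    refine (Finset.abs_sum_le_sum_abs _ _).trans ?_
    have h1 : ∀ i ∈ Finset.Icc 1 r,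
        |α i * ε i ω * ∫ t in dyadicInterval n k, Real.cos ((i : ℝ) * t)|
        ≤ if i < 2 ^ q then 2 * Real.pi / 2 ^ n else 0 := by
      intro i hi
      obtain ⟨hi1, hi2⟩ := Finset.mem_Icc.1 hi
      split_ifs with h
      · rw [abs_mul, abs_mul, hε i hi1, mul_one, ← dyadicPoint_sub n hk1]
        exact (mul_le_of_le_one_left (abs_nonneg _) (hα i)).trans
          (abs_setIntegral_cos_Ioc_le i (dyadicPoint_mono n (Nat.sub_le k 1)))
      · rw [hgap i (not_lt.1 h) hi2]; simp
    refine (Finset.sum_le_sum h1).trans ?_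
    rw [← Finset.sum_filter, Finset.sum_const, nsmul_eq_mul]
    gcongr
    have hc : ((Finset.Icc 1 r).filter (· < 2 ^ q)).card ≤ 2 ^ q := by
      refine (Finset.card_le_card (t := Finset.range (2 ^ q)) fun i hi => ?_).trans_eq
        (Finset.card_range _)
      exact Finset.mem_range.2 (Finset.mem_filter.1 hi).2
    exact_mod_cast hc
  refine (Finset.sum_le_card_nsmul _ _ _ hterm).trans ?_
  rw [Nat.card_Icc, Nat.add_sub_cancel, nsmul_eq_mul]
  obtain ⟨d, rfl⟩ := Nat.exists_eq_add_of_le hq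
  have hd : (1 : ℝ) ≤ 2 ^ d := one_le_pow₀ (by norm_num)
  have hp := Real.pi_lt_d2
  have hp2 : (2 * Real.pi) ^ 2 ≤ 64 := by nlinarith
  have hq0 : (0 : ℝ) < 2 ^ q := by positivity
  -- The total is $4\pi^2 2^{2q-n}$; the surplus $16$ in the exponent and $4\pi^2\le 64$ give
  -- $2^{-10}$.
  calc ((2 ^ (2 * q + 16 + d) : ℕ) : ℝ) * (2 ^ q * (2 * Real.pi / 2 ^ (2 * q + 16 + d))) ^ 2
      = (2 * Real.pi) ^ 2 / (2 ^ 16 * 2 ^ d) := by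
        push_cast
        rw [pow_add, pow_add, mul_comm 2 q, pow_mul]
        field_simp
    _ ≤ 64 / (2 ^ 16 * 1) := by gcongr
    _ = _ := by norm_num

lemma setIntegral_cos_dyadicInterval {i n k : ℕ} (hi : 1 ≤ i) (hk : 1 ≤ k) :
    ∫ t in dyadicInterval n k, Real.cos (i * t) = 2 / i * Real.sin (i * Real.pi / (2 ^ n : ℕ))
      * Real.cos (i * ((2 * (k : ℝ) - 1) * Real.pi / (2 ^ n : ℕ))) := by
  rw [dyadicInterval, setIntegral_cos_Ioc hi (dyadicPoint_mono n (Nat.sub_le k 1))]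
  have h1 : i * dyadicPoint n k = i * ((2 * (k : ℝ) - 1) * Real.pi / (2 ^ n : ℕ))
      + i * Real.pi / (2 ^ n : ℕ) := by
    unfold dyadicPoint; push_cast; ring
  have h2 : i * dyadicPoint n (k - 1) = i * ((2 * (k : ℝ) - 1) * Real.pi / (2 ^ n : ℕ))
      - i * Real.pi / (2 ^ n : ℕ) := by
    unfold dyadicPoint; rw [Nat.cast_sub hk]; push_cast; ring
  rw [h1, h2, Real.sin_add, Real.sin_sub]
  ring

omit [MeasurableSpace Ω] in
/-- The resonant block of frequencies `[2 ^ (n - 2), 2 ^ (n - 1))` contributes at least `9 / 4` to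
the dyadic sum of squares of level `n`. -/
lemma le_sum_block_sq {n : ℕ} (hn : 3 ≤ n) {ω : Ω} (hε : ∀ i, 1 ≤ i → |ε i ω| = 1)
    (hα1 : ∀ i, 2 ^ (n - 2) ≤ i → i < 2 ^ (n - 1) → α i = 1) :
    9 / 4 ≤ ∑ k ∈ Finset.Icc 1 (2 ^ n), (∑ i ∈ Finset.Ico (2 ^ (n - 2)) (2 ^ (n - 1)),
      α i * ε i ω * ∫ t in dyadicInterval n k, Real.cos ((i : ℝ) * t)) ^ 2 := by
  obtain ⟨m, rfl⟩ := Nat.exists_eq_add_of_le' hn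
  have e1 : 2 ^ (m + 3 - 2) = 2 * 2 ^ m := by
    rw [show m + 3 - 2 = m + 1 by omega, pow_succ, mul_comm]
  have e2 : 2 ^ (m + 3 - 1) = 4 * 2 ^ m := by
    rw [show m + 3 - 1 = m + 2 by omega, pow_add, mul_comm]
    norm_num
  have e3 : 2 ^ (m + 3) = 8 * 2 ^ m := by rw [pow_add, mul_comm]; norm_num
  have hpos : 1 ≤ 2 ^ m := Nat.one_le_two_pow
  rw [e1, e2] at hα1 ⊢
  refine (le_sum_sin_sq_div_sq hpos).trans (le_of_eq ?_)
  rw [← e3]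
  have hs : ∀ i ∈ Finset.Ico (2 * 2 ^ m) (4 * 2 ^ m), 0 < i ∧ 2 * i < 2 ^ (m + 3) := by
    intro i hi
    obtain ⟨hi1, hi2⟩ := Finset.mem_Ico.1 hi
    omega
  have hb : ∀ i : ℕ, i ∈ Finset.Ico (2 * 2 ^ m) (4 * 2 ^ m) →
      (2 / (i : ℝ) * Real.sin (i * Real.pi / (2 ^ (m + 3) : ℕ))) ^ 2
      = (α i * ε i ω * (2 / (i : ℝ) * Real.sin (i * Real.pi / (2 ^ (m + 3) : ℕ)))) ^ 2 := by
    intro i hi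
    obtain ⟨hi1, hi2⟩ := Finset.mem_Ico.1 hi
    rw [mul_pow (α i * ε i ω), hα1 i hi1 hi2, one_mul, ← sq_abs (ε i ω), hε i (hs i hi).1]
    ring
  rw [Finset.sum_congr rfl hb, ← sum_sq_sum_cos_odd hs]
  refine Finset.sum_congr rfl fun k hk => ?_
  congr 1
  refine Finset.sum_congr rfl fun i hi => ?_
  rw [setIntegral_cos_dyadicInterval (hs i hi).1 (Finset.mem_Icc.1 hk).1]
  ring

omit [MeasurableSpace Ω] in
/-- If the low frequencies `i < 2 ^ (n - 1)` are sparse enough and the remainder is small, then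
the dyadic sum is small. -/
lemma dyadicSum_lt_one (hα : ∀ i, |α i| ≤ 1) {ω : Ω} (hε : ∀ i, 1 ≤ i → |ε i ω| = 1)
    {n q r : ℕ} (hgap : ∀ i, 2 ^ q ≤ i → i ≤ r → α i = 0) (hq : 2 * q + 16 ≤ n)
    (hr : remainderSum α ε n r ω < 1 / 2 ^ 10) :
    dyadicSum (fourierMeasure α ε) n ω < 1 := by
  have h1 := sum_partialSum_sq_le hα hε hgap hq
  have h2 : dyadicSum (fourierMeasure α ε) n ω
      ≤ 2 * ∑ k ∈ Finset.Icc 1 (2 ^ n), partialSum α ε (dyadicInterval n k) r ω ^ 2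
        + 2 * remainderSum α ε n r ω := by
    rw [dyadicSum, remainderSum, Finset.mul_sum, Finset.mul_sum, ← Finset.sum_add_distrib]
    refine Finset.sum_le_sum fun k _ => ?_
    nlinarith [sq_nonneg (fourierMeasure α ε (dyadicInterval n k) ω
      - 2 * partialSum α ε (dyadicInterval n k) r ω)]
  norm_num at h1 hr
  linarith

omit [MeasurableSpace Ω] in
/-- If all frequencies of the resonant block are present and the other contributions are small, then
the dyadic sum is at least `2`. -/
lemma two_le_dyadicSum (hα : ∀ i, |α i| ≤ 1) {ω : Ω} (hε : ∀ i, 1 ≤ i → |ε i ω| = 1)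
    {n q : ℕ} (hα1 : ∀ i, 2 ^ (n - 2) ≤ i → i < 2 ^ (n - 1) → α i = 1)
    (hgap : ∀ i, 2 ^ q ≤ i → i < 2 ^ (n - 2) → α i = 0) (hq : 2 * q + 16 ≤ n)
    (hr : remainderSum α ε n (2 ^ (n - 1) - 1) ω < 1 / 2 ^ 10) :
    2 ≤ dyadicSum (fourierMeasure α ε) n ω := by
  have hp2 : 1 ≤ 2 ^ (n - 2) := Nat.one_le_two_pow
  have hp12 : 2 ^ (n - 2) ≤ 2 ^ (n - 1) := Nat.pow_le_pow_right (by norm_num) (by omega)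
  have h1 := sum_partialSum_sq_le (r := 2 ^ (n - 2) - 1) hα hε
    (fun i h1 h2 => hgap i h1 (by omega)) hq
  have hB := le_sum_block_sq (by omega) hε hα1
  set B : ℕ → ℝ := fun k => ∑ i ∈ Finset.Ico (2 ^ (n - 2)) (2 ^ (n - 1)),
    α i * ε i ω * ∫ t in dyadicInterval n k, Real.cos ((i : ℝ) * t)
  set D : ℕ → ℝ := fun k => partialSum α ε (dyadicInterval n k) (2 ^ (n - 2) - 1) ω
  have hsplit : ∀ k, partialSum α ε (dyadicInterval n k) (2 ^ (n - 1) - 1) ω = D k + B k := by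
    intro k
    have e : ∀ x : ℕ, 1 ≤ x → Finset.Icc 1 (x - 1) = Finset.Ico 1 x := by
      intro x hx
      ext i
      simp only [Finset.mem_Icc, Finset.mem_Ico]
      omega
    simp only [D, B, partialSum]
    rw [e _ (hp2.trans hp12), e _ hp2, Finset.sum_Ico_consecutive _ hp2 hp12]
  -- With $E=D+R$, one has $(B+E)^2+17E^2=\frac{17}{18}B^2+18(E+B/18)^2$. The weight suffices
  -- because $\frac{17}{18}\cdot\frac94=\frac{17}8$ exceeds $2$ by more than the error
  -- $17\cdot4\cdot2^{-10}$.
  have h2 : 17 / 18 * ∑ k ∈ Finset.Icc 1 (2 ^ n), B k ^ 2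
      ≤ dyadicSum (fourierMeasure α ε) n ω + 17 * (2 * ∑ k ∈ Finset.Icc 1 (2 ^ n), D k ^ 2
        + 2 * remainderSum α ε n (2 ^ (n - 1) - 1) ω) := by
    rw [dyadicSum, remainderSum]
    simp only [Finset.mul_sum, ← Finset.sum_add_distrib]
    refine Finset.sum_le_sum fun k _ => ?_
    rw [hsplit]
    obtain ⟨R, hR⟩ : ∃ R, fourierMeasure α ε (dyadicInterval n k) ω = D k + B k + R :=
      ⟨_, (add_sub_cancel _ _).symm⟩
    rw [hR]
    nlinarith [sq_nonneg (B k + 18 * (D k + R)), sq_nonneg (D k - R)]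
  norm_num at h1 hr
  linarith

/-! ### Block coefficients -/

lemma abs_blockCoeff_le (n : ℕ → ℕ) (i : ℕ) : |blockCoeff n i| ≤ 1 := by
  unfold blockCoeff
  split_ifs <;> simp

lemma blockCoeff_eq_one {n : ℕ → ℕ} {i j : ℕ} (h1 : 2 ^ (n j - 2) ≤ i) (h2 : i < 2 ^ (n j - 1)) :
    blockCoeff n i = 1 :=
  if_pos ⟨j, h1, h2⟩

lemma blockCoeff_eq_zero_of_gap {n : ℕ → ℕ} (hn : Monotone n) {i j : ℕ}
    (h1 : 2 ^ (n j - 1) ≤ i) (h2 : i < 2 ^ (n (j + 1) - 2)) : blockCoeff n i = 0 := by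
  refine if_neg ?_
  rintro ⟨l, hl1, hl2⟩
  rcases le_or_gt l j with hlj | hlj
  · exact absurd (hl2.trans_le ((Nat.pow_le_pow_right (by norm_num)
      (Nat.sub_le_sub_right (hn hlj) 1)).trans h1)) (lt_irrefl _)
  · exact absurd (h2.trans_le ((Nat.pow_le_pow_right (by norm_num)
      (Nat.sub_le_sub_right (hn hlj) 2)).trans hl1)) (lt_irrefl _)

lemma blockCoeff_eq_zero_of_lt_first {n : ℕ → ℕ} (hn : Monotone n) {i : ℕ}
    (h : i < 2 ^ (n 0 - 2)) : blockCoeff n i = 0 := by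
  refine if_neg ?_
  rintro ⟨l, hl1, -⟩
  exact absurd (h.trans_le ((Nat.pow_le_pow_right (by norm_num)
    (Nat.sub_le_sub_right (hn (Nat.zero_le l)) 2)).trans hl1)) (lt_irrefl _)

/-- The levels `n j = K * 9 ^ j`. -/
def level (K j : ℕ) : ℕ := K * 9 ^ j

lemma level_succ (K j : ℕ) : level K (j + 1) = 9 * level K j := by
  simp only [level, pow_succ]; ring

lemma level_mono (K : ℕ) : Monotone (level K) := fun _ _ h =>
  Nat.mul_le_mul_left _ (Nat.pow_le_pow_right (by norm_num) h)

lemma add_le_level {K : ℕ} (hK : 1 ≤ K) (j : ℕ) : K + j ≤ level K j := by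
  induction j with
  | zero => simp [level]
  | succ j ih => rw [level_succ]; omega

/-- The earlier blocks end before $2^{q}$ with $q$ the previous level, and the growth factor $9$
gives $2q+16\le 9q$. Before the first block there is nothing, so $q=0$ works. -/
lemma exists_sparse_below_block {K : ℕ} (hK : 32 ≤ K) (j : ℕ) :
    ∃ q, 2 * q + 16 ≤ level K j ∧
      ∀ i, 2 ^ q ≤ i → i < 2 ^ (level K j - 2) → blockCoeff (level K) i = 0 := by
  cases j with
  | zero =>
    exact ⟨0, by have := add_le_level (K := K) (by omega) 0; omega, fun i _ hi =>
      blockCoeff_eq_zero_of_lt_first (level_mono K) hi⟩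
  | succ j =>
    refine ⟨level K j, ?_, fun i h1 h2 => blockCoeff_eq_zero_of_gap (level_mono K) (j := j) ?_ h2⟩
    · have := add_le_level (K := K) (by omega) j
      rw [level_succ]; omega
    · exact (Nat.pow_le_pow_right (by norm_num) (Nat.sub_le _ 1)).trans h1

/-- The exceptional event of index `j`: a remainder at level `n j` or `3 * n j` is large. -/
def exceptionalEvent (K : ℕ) (ε : ℕ → Ω → ℝ) (j : ℕ) : Set Ω :=
  {ω | 1 / 2 ^ 10 ≤ remainderSum (blockCoeff (level K)) ε (level K j) (2 ^ (level K j - 1) - 1) ω} ∪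
  {ω | 1 / 2 ^ 10 ≤
    remainderSum (blockCoeff (level K)) ε (3 * level K j) (2 ^ (level K j - 1) - 1) ω}

lemma measure_exceptionalEvent_le (h : IsBernoulliSequence P ε) {K : ℕ} (hK : 32 ≤ K) (j : ℕ) :
    P (exceptionalEvent K ε j) ≤ ENNReal.ofReal ((1 / 2) ^ K * (1 / 2) ^ j) := by
  have hL := add_le_level (K := K) (by omega) j
  have key : ∀ n, n ≤ 3 * level K j → P {ω | 1 / 2 ^ 10 ≤
      remainderSum (blockCoeff (level K)) ε n (2 ^ (level K j - 1) - 1) ω}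
      ≤ ENNReal.ofReal ((1 / 2) ^ (K + j + 1)) := by
    intro n hn
    refine (measure_le_remainderSum_le h (abs_blockCoeff_le _) (M := 2 ^ (level K (j + 1) - 2))
      Nat.one_le_two_pow (fun i h1 h2 => ?_) (by norm_num)).trans (ENNReal.ofReal_le_ofReal ?_)
    · exact blockCoeff_eq_zero_of_gap (level_mono K) (j := j) (by omega) h2
    -- The $13$ pays for the factor $8=2^3$ and the threshold $2^{-10}$. The factor $9$ leaves room
    -- for it even at $n=3n_j$.
    · obtain ⟨d, hd⟩ : ∃ d, level K (j + 1) - 2 = n + (K + j + 1) + 13 + d :=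
        Nat.exists_eq_add_of_le (by rw [level_succ]; omega)
      have hd1 : (1 : ℝ) ≤ 2 ^ d := one_le_pow₀ (by norm_num)
      rw [hd]
      push_cast
      calc (2 : ℝ) ^ n * (8 / 2 ^ (n + (K + j + 1) + 13 + d)) / (1 / 2 ^ 10)
          = (1 / 2) ^ (K + j + 1) * (1 / 2 ^ d) := by
            rw [pow_add _ _ d, pow_add _ _ 13, pow_add _ n, one_div_pow]
            field_simp
            norm_num
        _ ≤ _ := mul_le_of_le_one_right (by positivity) ((div_le_one (by positivity)).2 hd1)
  refine (measure_union_le _ _).trans ((add_le_add (key _ (by omega)) (key _ le_rfl)).trans ?_)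
  rw [← ENNReal.ofReal_add (by positivity) (by positivity)]
  refine ENNReal.ofReal_le_ofReal (le_of_eq ?_)
  rw [pow_succ, pow_add]
  ring

lemma hasSum_exceptional_bound (K : ℕ) :
    HasSum (fun j : ℕ => ((1 / 2 : ℝ) ^ K * (1 / 2) ^ j)) ((1 / 2) ^ K * 2) :=
  hasSum_geometric_two.mul_left _

lemma tsum_measure_exceptionalEvent_le (h : IsBernoulliSequence P ε) {K : ℕ} (hK : 32 ≤ K) :
    ∑' j, P (exceptionalEvent K ε j) ≤ ENNReal.ofReal ((1 / 2) ^ K * 2) := by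
  refine (ENNReal.tsum_le_tsum (measure_exceptionalEvent_le h hK)).trans (le_of_eq ?_)
  rw [← ENNReal.ofReal_tsum_of_nonneg (fun j => by positivity) (hasSum_exceptional_bound K).summable,
    (hasSum_exceptional_bound K).tsum_eq]

lemma oscillation_of_notMem_exceptionalEvent (h : IsBernoulliSequence P ε) {K : ℕ} (hK : 32 ≤ K) :
    ∀ᵐ ω ∂P, ∀ j, ω ∉ exceptionalEvent K ε j →
      2 ≤ dyadicSum (fourierMeasure (blockCoeff (level K)) ε) (level K j) ω ∧
      dyadicSum (fourierMeasure (blockCoeff (level K)) ε) (3 * level K j) ω < 1 := by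
  filter_upwards [h.ae_abs_eq_one] with ω hω j hj
  have hL := add_le_level (K := K) (by omega) j
  rw [exceptionalEvent, Set.mem_union, not_or] at hj
  obtain ⟨q, hq, hgap⟩ := exists_sparse_below_block hK j
  -- At level $3n_j$ the block $j$ itself counts as low frequency: $q=n_j$ is admissible since
  -- $n_j\ge32\ge16$.
  refine ⟨two_le_dyadicSum (abs_blockCoeff_le _) hω (fun i h1 h2 => blockCoeff_eq_one h1 h2)
    hgap hq (not_le.1 hj.1), dyadicSum_lt_one (q := level K j) (abs_blockCoeff_le _) hω
    (fun i h1 h2 => ?_) (by omega) (not_le.1 hj.2)⟩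
  have h3 : 2 ^ (level K j - 1) ≤ 2 ^ level K j :=
    Nat.pow_le_pow_right (by norm_num) (Nat.sub_le _ 1)
  have h4 : 1 ≤ 2 ^ (level K j - 1) := Nat.one_le_two_pow
  omega

/-! ### Absence of limits -/

lemma not_tendsto_of_oscillation {u : ℕ → ℝ} {n m : ℕ → ℕ} {a b : ℝ} (hab : b < a)
    (hn : Tendsto n atTop atTop) (hm : Tendsto m atTop atTop)
    (hu : ∀ᶠ j in atTop, a ≤ u (n j) ∧ u (m j) ≤ b) : ¬ ∃ L, Tendsto u atTop (𝓝 L) := by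
  rintro ⟨L, hL⟩
  have h1 := ge_of_tendsto (hL.comp hn) (hu.mono fun j hj => hj.1)
  have h2 := le_of_tendsto (hL.comp hm) (hu.mono fun j hj => hj.2)
  linarith

/-- A limit in probability would be the almost sure limit of further subsequences of both `F ∘ n`
and `F ∘ m`, hence at once at least `a` and at most `b`. -/
lemma not_tendstoInMeasure_of_oscillation {F : ℕ → Ω → ℝ} {n m : ℕ → ℕ} {a b : ℝ} (hab : b < a)
    (hn : Tendsto n atTop atTop) (hm : Tendsto m atTop atTop)
    (hF : ∀ᵐ ω ∂P, ∀ᶠ j in atTop, a ≤ F (n j) ω ∧ F (m j) ω ≤ b) :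
    ¬ ∃ Z : Ω → ℝ, TendstoInMeasure P F atTop Z := by
  rintro ⟨Z, hZ⟩
  obtain ⟨k, hk, hk'⟩ := (hZ.comp hn).exists_seq_tendsto_ae
  obtain ⟨l, hl, hl'⟩ := (hZ.comp hm).exists_seq_tendsto_ae
  obtain ⟨ω, h1, h2, h3⟩ := (hk'.and (hl'.and hF)).exists
  have h4 := ge_of_tendsto h1 (hk.tendsto_atTop.eventually (h3.mono fun j hj => hj.1))
  have h5 := le_of_tendsto h2 (hl.tendsto_atTop.eventually (h3.mono fun j hj => hj.2))
  linarith

omit [MeasurableSpace Ω] in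
lemma fourierMeasure_Ioc_zero_two_pi (α : ℕ → ℝ) (ε : ℕ → Ω → ℝ) (ω : Ω) :
    path (fourierMeasure α ε) (2 * Real.pi) ω = 0 := by
  refine fourierMeasure_eq_of_tendsto (tendsto_const_nhds.congr fun p => ?_)
  rw [partialSum_Ioc α ε (by have := Real.pi_pos; positivity)]
  refine (Finset.sum_eq_zero fun i _ => ?_).symm
  have : Real.sin (i * (2 * Real.pi)) = 0 := by
    have := Real.sin_nat_mul_pi (2 * i)
    rw [← this]; push_cast; ring_nf
  simp [this]

/-- Summation by parts: `μ_{2π}² = S_n + 2 ∑ μ_{t_{k-1}} μ(Δ_{kn})`, and `μ_{2π} = 0`. -/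
lemma itoSum_eq (h : IsBernoulliSequence P ε) (hα : ∀ i, |α i| ≤ 1) :
    ∀ᵐ ω ∂P, ∀ n, itoSum (fourierMeasure α ε) (fun x => x) n ω
      = -(dyadicSum (fourierMeasure α ε) n ω) / 2 := by
  have hadd : ∀ᵐ ω ∂P, ∀ n k, k + 1 ≤ 2 ^ n →
      path (fourierMeasure α ε) (dyadicPoint n (k + 1)) ω
        = path (fourierMeasure α ε) (dyadicPoint n k) ω
          + fourierMeasure α ε (dyadicInterval n (k + 1)) ω := by
    simp only [ae_all_iff]
    intro n k hk
    have hsub : Set.Ioc 0 (dyadicPoint n k) ⊆ Set.Icc 0 (2 * Real.pi) := fun x hx =>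
      ⟨hx.1.le, hx.2.trans (dyadicPoint_le n (by omega))⟩
    have hun : Set.Ioc 0 (dyadicPoint n (k + 1))
        = Set.Ioc 0 (dyadicPoint n k) ∪ dyadicInterval n (k + 1) :=
      (Set.Ioc_union_Ioc_eq_Ioc (dyadicPoint_nonneg n k) (dyadicPoint_mono n (by omega))).symm
    simp only [path]
    rw [hun]
    exact fourierMeasure_union h hα measurableSet_Ioc hsub (measurableSet_dyadicInterval _ _)
      (dyadicInterval_subset hk) (Set.disjoint_left.2 fun x hx hx' => not_lt.2 hx.2 hx'.1)
  filter_upwards [hadd] with ω hω n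
  have key : ∀ K, K ≤ 2 ^ n → path (fourierMeasure α ε) (dyadicPoint n K) ω ^ 2
      = ∑ k ∈ Finset.Icc 1 K, fourierMeasure α ε (dyadicInterval n k) ω ^ 2
        + 2 * ∑ k ∈ Finset.Icc 1 K, path (fourierMeasure α ε) (dyadicPoint n (k - 1)) ω
          * fourierMeasure α ε (dyadicInterval n k) ω := by
    intro K
    induction K with
    | zero =>
      intro _
      have : path (fourierMeasure α ε) 0 ω = 0 :=
        fourierMeasure_eq_of_tendsto (tendsto_const_nhds.congr fun p => by simp [partialSum])
      simp [dyadicPoint_zero, this]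
    | succ K ih =>
      intro hK
      rw [Finset.sum_Icc_succ_top (by omega), Finset.sum_Icc_succ_top (by omega), hω n K hK,
        Nat.add_sub_cancel, add_sq, ih (by omega)]
      ring
  have := key (2 ^ n) le_rfl
  rw [dyadicPoint_two_pow, fourierMeasure_Ioc_zero_two_pi] at this
  simp only [itoSum, dyadicSum]
  linarith

end StochMeas

/-! ### Assembly of the counterexample -/

theorem mainTheorem7 (δ : ℝ) (hδ : 0 < δ) :
    ∃ n m : ℕ → ℕ, (∀ j, 2 ≤ n j) ∧ (∀ j, n j < m j ∧ m j < n (j + 1)) ∧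
      ∀ (Ω : Type*) [MeasurableSpace Ω] (P : Measure Ω) [IsProbabilityMeasure P]
        (ε : ℕ → Ω → ℝ), StochMeas.IsBernoulliSequence P ε →
        ∃ μ : Set ℝ → Ω → ℝ,
          StochMeas.IsFourierSeriesMeasure P (StochMeas.blockCoeff n) ε μ ∧
          StochMeas.IsStochasticMeasureOn P (Set.Icc 0 (2 * Real.pi)) μ ∧
          (∀ᵐ ω ∂P, ContinuousOn (fun t => StochMeas.path μ t ω) (Set.Icc 0 (2 * Real.pi)) ∧
            ∀ γ : ℝ≥0, γ < 1 / 2 → ∃ C : ℝ≥0,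
              HolderOnWith C γ (fun t => StochMeas.path μ t ω) (Set.Icc 0 (2 * Real.pi))) ∧
          (∀ᵐ ω ∂P, ∀ᶠ j in atTop,
            2 ≤ StochMeas.dyadicSum μ (n j) ω ∧ StochMeas.dyadicSum μ (m j) ω < 1) ∧
          1 - δ ≤ P.real {ω | ∀ j,
            2 ≤ StochMeas.dyadicSum μ (n j) ω ∧ StochMeas.dyadicSum μ (m j) ω < 1} ∧
          (∀ᵐ ω ∂P, ¬ ∃ L : ℝ,
            Tendsto (fun N => StochMeas.dyadicSum μ N ω) atTop (𝓝 L)) ∧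
          (¬ ∃ Z : Ω → ℝ, TendstoInMeasure P (StochMeas.dyadicSum μ) atTop Z) ∧
          (¬ ∃ Z : Ω → ℝ, TendstoInMeasure P (StochMeas.itoSum μ (fun x => x)) atTop Z) := by
  -- The exceptional probabilities sum to at most $2\cdot2^{-K}$, which must not exceed $\delta$.
  obtain ⟨K₀, hK₀⟩ := exists_pow_lt_of_lt_one (half_pos hδ) (by norm_num : (1 / 2 : ℝ) < 1)
  set K := max K₀ 32
  have hK : 32 ≤ K := le_max_right _ _
  have hKδ : (1 / 2 : ℝ) ^ K * 2 ≤ δ := by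
    have : (1 / 2 : ℝ) ^ K ≤ (1 / 2) ^ K₀ :=
      pow_le_pow_of_le_one (by norm_num) (by norm_num) (le_max_left _ _)
    linarith
  have hL := StochMeas.add_le_level (K := K) (by omega)
  have hn : Tendsto (StochMeas.level K) atTop atTop :=
    tendsto_atTop_mono (fun j => (Nat.le_add_left j K).trans (hL j)) tendsto_id
  have hm : Tendsto (fun j => 3 * StochMeas.level K j) atTop atTop :=
    tendsto_atTop_mono (fun j => Nat.le_mul_of_pos_left _ (by norm_num)) hn
  refine ⟨StochMeas.level K, fun j => 3 * StochMeas.level K j, fun j => ?_, fun j => ?_, ?_⟩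
  · have := hL j; omega
  · have := hL j; have := StochMeas.level_succ K j; dsimp only; omega
  intro Ω _ P _ ε h
  have hα := StochMeas.abs_blockCoeff_le (StochMeas.level K)
  have hbad := StochMeas.tsum_measure_exceptionalEvent_le h hK
  have hosc := StochMeas.oscillation_of_notMem_exceptionalEvent h hK
  set μ := StochMeas.fourierMeasure (StochMeas.blockCoeff (StochMeas.level K)) ε
  have hev : ∀ᵐ ω ∂P, ∀ᶠ j in atTop, 2 ≤ StochMeas.dyadicSum μ (StochMeas.level K j) ω ∧
      StochMeas.dyadicSum μ (3 * StochMeas.level K j) ω < 1 := by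
    filter_upwards [ae_eventually_notMem (hbad.trans_lt ENNReal.ofReal_lt_top).ne, hosc]
      with ω h1 h2
    exact h1.mono fun j hj => h2 j hj
  refine ⟨μ, fun A hA hA' => StochMeas.ae_tendsto_partialSum h hα hA hA',
    StochMeas.isStochasticMeasureOn_fourierMeasure h hα, ?_, hev, ?_, ?_, ?_, ?_⟩
  · filter_upwards [StochMeas.ae_holderOnWith_path h hα] with ω hω
    refine ⟨?_, hω⟩
    obtain ⟨C, hC⟩ := hω (1 / 4) (by rw [← NNReal.coe_lt_coe]; norm_num)
    exact hC.continuousOn (by norm_num)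
  · set G : Set Ω := {ω | ∀ j, 2 ≤ StochMeas.dyadicSum μ (StochMeas.level K j) ω ∧
      StochMeas.dyadicSum μ (3 * StochMeas.level K j) ω < 1}
    have hGc : P Gᶜ ≤ ENNReal.ofReal δ := by
      have hsub : Gᶜ ≤ᵐ[P] ⋃ j, StochMeas.exceptionalEvent K ε j := by
        filter_upwards [hosc] with ω hω hG
        by_contra hn
        refine hG fun j => hω j fun hj => hn ?_
        exact Set.mem_iUnion.2 ⟨j, hj⟩
      exact (measure_mono_ae hsub).trans ((measure_iUnion_le _).trans
        (hbad.trans (ENNReal.ofReal_le_ofReal hKδ)))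
    have h1 : P.real Gᶜ ≤ δ := ENNReal.toReal_le_of_le_ofReal hδ.le hGc
    -- Subadditivity gives the lower bound for `G` without its measurability.
    have h2 := measureReal_union_le (μ := P) G Gᶜ
    rw [Set.union_compl_self, probReal_univ] at h2
    linarith
  · filter_upwards [hev] with ω hω
    exact StochMeas.not_tendsto_of_oscillation (by norm_num : (1 : ℝ) < 2) hn hm
      (hω.mono fun j hj => ⟨hj.1, hj.2.le⟩)
  · refine StochMeas.not_tendstoInMeasure_of_oscillation (by norm_num : (1 : ℝ) < 2) hn hm ?_
    filter_upwards [hev] with ω hω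
    exact hω.mono fun j hj => ⟨hj.1, hj.2.le⟩
  -- The Itô sum is $-S_n/2$, so the roles swap: it is above $-1/2$ along $\tilde n_j$ and at most
  -- $-1$ along $n_j$.
  · refine StochMeas.not_tendstoInMeasure_of_oscillation (a := -1 / 2) (b := -1) (by norm_num)
      hm hn ?_
    filter_upwards [hev, StochMeas.itoSum_eq h hα] with ω hω hito
    refine hω.mono fun j hj => ?_
    rw [hito, hito]
    constructor <;> linarith [hj.1, hj.2]
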